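/- **Setting.** Let $(W,S)$ be a finite Coxeter group, $m_{st}$ the order of $st$, and let $k\subseteq\mathbb{C}$ be a good ring for $W$, i.e. a subring with $2\cos(2\pi/m_{st})\in k$ for all $s,t\in S$. The *$W$-graph algebra* $\Omega=\Omega(W,S)$ is the quotient of the free ring $\mathbb{Z}\langle e_s,x_s\mid s\in S\rangle$ by the relations $e_s^2=e_s$, $e_se_t=e_te_s$, $e_sx_s=x_s$, $x_se_s=0$ and $y^\gamma(s,t)=0$ for all $s,t\in S$, $\gamma\in\mathbb{Z}$. Here, with $\iota(T_s)=-v^{-1}e_s+v(1-e_s)+x_s$, the elements $y^\gamma(s,t)\in\mathbb{Z}\langle e_s,x_s\rangle$ are defined by $$\underbrace{\iota(T_s)\iota(T_t)\iota(T_s)\cdots}_{m_{st}}-\underbrace{\iota(T_t)\iota(T_s)\iota(T_t)\cdots}_{m_{st}}=\sum_{\gamma\in\mathbb{Z}} y^\gamma(s,t)\,v^\gamma .$$ Write $k\Omega=k\otimes_{\mathbb{Z}}\Omega$. For $I,J\subseteq S$ and $s\in S$ put $E_I=\prod_{t\in I}e_t\prod_{t\in S\setminus I}(1-e_t)$ and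 $X^s_{IJ}=E_Ix_sE_J$. There is an *edge* $I\leftarrow J$ if $I\setminus J\neq\emptyset$ and no element of $I\setminus J$ commutes with an element of $J\setminus I$; the edge is *transversal* if moreover $J\setminus I\neq\emptyset$. For an edge $I\leftarrow J$ the element $X_{IJ}:=X_{IJ}^s$ does not depend on the choice of $s\in I\setminus J$. Let $\Psi=\Psi(W,S)$ be the subalgebra of $\Omega$ generated by all $E_I$ and all $X_{IJ}$ with $I\leftarrow J$ transversal, and let $k\Psi$ be the $k$-span of its image in $k\Omega$. Let $\mathrm{Irr}(W)$ be the set of irreducible complex characters of $W$ and $d_\lambda=\lambda(1)$. The *strong $W$-graph decomposition conjecture* for $(W,S)$ over $k$ asserts that there are elements $(F^\lambda)_{\lambda\in\mathrm{Irr}(W)}$ of $k\Omega$ and a partial order $\preceq$ on $\mathrm{Irr}(W)$ such that - (Z1) $F^\lambda F^\mu=\delta_{\lambda\mu}F^\lambda$ for all $\lambda,\mu$, and $\sum_\lambda F^\lambda=1$; - (Z2) $E_IF^\lambda=F^\lambda E_I$ for all $\lambda$ and all $I\subseteq S$; - (Z3) if $F^\lambda\, k\Omega\, F^\mu\neq0$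 then $\lambda\preceq\mu$; - (Z4) for every $\lambda$ there is a surjective morphism of $k$-algebras $\psi_\lambda:k^{d_\lambda\times d_\lambda}\twoheadrightarrow F^\lambda\, k\Omega\, F^\lambda$ (the unit of the target being $F^\lambda$); - (Z5) $F^\lambda X_{IJ}F^\lambda\in k\Psi$ for every $\lambda$ and every edge $I\leftarrow J$; - (Z6) $F^\lambda\in k\Psi$ for every $\lambda$. **Theorem.** Let $(W_1,S_1)$ and $(W_2,S_2)$ be finite Coxeter groups, let $W=W_1\times W_2$ with $S=S_1\sqcup S_2$, and let $k\subseteq\mathbb{C}$ be a good ring for $W$. If $(W_1,S_1)$ and $(W_2,S_2)$ satisfy the strong $W$-graph decomposition conjecture over $k$, then so does $(W,S)$. More precisely, $(\lambda,\mu)\mapsto\lambda\boxtimes\mu$, $(\lambda\boxtimes\mu)(w_1,w_2)=\lambda(w_1)\mu(w_2)$, is a bijection $\mathrm{Irr}(W_1)\times\mathrm{Irr}(W_2)\to\mathrm{Irr}(W)$. Let $\iota_i:k\Omega(W_i,S_i)\to k\Omega(W,S)$ be the $k$-algebra morphisms with $e_s\mapsto e_s$, $x_s\mapsto x_s$ for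 $s\in S_i$. Whenever $(F^\lambda)_{\lambda\in\mathrm{Irr}(W_1)},\preceq_1$ and $(F^\mu)_{\mu\in\mathrm{Irr}(W_2)},\preceq_2$ satisfy (Z1)–(Z6) for $W_1$ and $W_2$, the elements $F^{\lambda\boxtimes\mu}=\iota_1(F^\lambda)\,\iota_2(F^\mu)$ and the product order, $\lambda\boxtimes\mu\preceq\lambda'\boxtimes\mu'\iff\lambda\preceq_1\lambda'$ and $\mu\preceq_2\mu'$, satisfy (Z1)–(Z6) for $W$. -/

import Mathlib

open scoped TensorProduct

/-! ### Products of Coxeter systems -/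

/-- The Coxeter matrix of `W₁ × W₂`, indexed by `S = S₁ ⊔ S₂`: the generators in `S₁` commute with
those in `S₂`. -/
def CoxeterMatrix.prod {B₁ B₂ : Type*} (M₁ : CoxeterMatrix B₁) (M₂ : CoxeterMatrix B₂) :
    CoxeterMatrix (B₁ ⊕ B₂) where
  M := Matrix.of fun s t => match s, t with
    | .inl i, .inl j => M₁ i j
    | .inr i, .inr j => M₂ i j
    | .inl _, .inr _ => 2
    | .inr _, .inl _ => 2
  isSymm := by
    refine Matrix.IsSymm.ext fun s t => ?_
    rcases s with i | i <;> rcases t with j | j <;>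
      first | rfl | exact M₁.symmetric _ _ | exact M₂.symmetric _ _
  diagonal s := by
    rcases s with i | i
    · exact M₁.diagonal i
    · exact M₂.diagonal i
  off_diagonal s t h := by
    rcases s with i | i <;> rcases t with j | j
    · exact M₁.off_diagonal i j fun e => h (congrArg _ e)
    · exact (by decide : (2 : ℕ) ≠ 1)
    · exact (by decide : (2 : ℕ) ≠ 1)
    · exact M₂.off_diagonal i j fun e => h (congrArg _ e)

namespace CoxeterSystem

variable {B₁ B₂ W₁ W₂ : Type*} [Group W₁] [Group W₂]
  {M₁ : CoxeterMatrix B₁} {M₂ : CoxeterMatrix B₂}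

/-- The homomorphism from the abstract Coxeter group of the product matrix to `W₁ × W₂`. -/
def prodHom (cs₁ : CoxeterSystem M₁ W₁) (cs₂ : CoxeterSystem M₂ W₂) :
    (M₁.prod M₂).Group →* W₁ × W₂ :=
  (M₁.prod M₂).toCoxeterSystem.lift
    ⟨Sum.elim (fun i => (cs₁.simple i, 1)) (fun j => (1, cs₂.simple j)), by
      rintro (i | i) (j | j)
      · exact Prod.ext (cs₁.simple_mul_simple_pow i j) (by simp)
      · have h : (M₁.prod M₂) (.inl i) (.inr j) = 2 := rfl
        rw [h]; simp [pow_two]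
      · have h : (M₁.prod M₂) (.inr i) (.inl j) = 2 := rfl
        rw [h]; simp [pow_two]
      · exact Prod.ext (by simp) (cs₂.simple_mul_simple_pow i j)⟩

theorem prodHom_inl (cs₁ : CoxeterSystem M₁ W₁) (cs₂ : CoxeterSystem M₂ W₂) (i : B₁) :
    prodHom cs₁ cs₂ ((M₁.prod M₂).toCoxeterSystem.simple (.inl i)) = (cs₁.simple i, 1) :=
  (M₁.prod M₂).toCoxeterSystem.lift_apply_simple _ (.inl i)

theorem prodHom_inr (cs₁ : CoxeterSystem M₁ W₁) (cs₂ : CoxeterSystem M₂ W₂) (j : B₂) :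
    prodHom cs₁ cs₂ ((M₁.prod M₂).toCoxeterSystem.simple (.inr j)) = (1, cs₂.simple j) :=
  (M₁.prod M₂).toCoxeterSystem.lift_apply_simple _ (.inr j)

/-- The homomorphism from `W₁` to the abstract Coxeter group of the product matrix. -/
def prodInl (cs₁ : CoxeterSystem M₁ W₁) (M₂ : CoxeterMatrix B₂) : W₁ →* (M₁.prod M₂).Group :=
  cs₁.lift ⟨fun i => (M₁.prod M₂).toCoxeterSystem.simple (.inl i), fun i j =>
    (M₁.prod M₂).toCoxeterSystem.simple_mul_simple_pow (.inl i) (.inl j)⟩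

theorem prodInl_simple (cs₁ : CoxeterSystem M₁ W₁) (M₂ : CoxeterMatrix B₂) (i : B₁) :
    cs₁.prodInl M₂ (cs₁.simple i) = (M₁.prod M₂).toCoxeterSystem.simple (.inl i) :=
  cs₁.lift_apply_simple _ i

/-- The homomorphism from `W₂` to the abstract Coxeter group of the product matrix. -/
def prodInr (M₁ : CoxeterMatrix B₁) (cs₂ : CoxeterSystem M₂ W₂) : W₂ →* (M₁.prod M₂).Group :=
  cs₂.lift ⟨fun i => (M₁.prod M₂).toCoxeterSystem.simple (.inr i), fun i j =>
    (M₁.prod M₂).toCoxeterSystem.simple_mul_simple_pow (.inr i) (.inr j)⟩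

theorem prodInr_simple (M₁ : CoxeterMatrix B₁) (cs₂ : CoxeterSystem M₂ W₂) (j : B₂) :
    prodInr M₁ cs₂ (cs₂.simple j) = (M₁.prod M₂).toCoxeterSystem.simple (.inr j) :=
  cs₂.lift_apply_simple _ j

theorem prodInl_commute (cs₁ : CoxeterSystem M₁ W₁) (cs₂ : CoxeterSystem M₂ W₂)
    (a : W₁) (b : W₂) : Commute (cs₁.prodInl M₂ a) (prodInr M₁ cs₂ b) := by
  refine cs₁.simple_induction (p := fun a => Commute (cs₁.prodInl M₂ a) (prodInr M₁ cs₂ b))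
    a ?_ ?_ ?_
  · intro i
    refine cs₂.simple_induction
      (p := fun b => Commute (cs₁.prodInl M₂ (cs₁.simple i)) (prodInr M₁ cs₂ b)) b ?_ ?_ ?_
    · intro j
      rw [prodInl_simple, prodInr_simple]
      have h := (M₁.prod M₂).toCoxeterSystem.simple_mul_simple_pow (.inl i) (.inr j)
      have h2 : (M₁.prod M₂) (.inl i) (.inr j) = 2 := rfl
      rw [h2, pow_two] at h
      have h3 := eq_inv_of_mul_eq_one_left h
      rw [mul_inv_rev, inv_simple, inv_simple] at h3
      exact h3
    · rw [map_one]; exact Commute.one_right _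
    · intro w w' h h'
      rw [map_mul]; exact h.mul_right h'
  · rw [map_one]; exact Commute.one_left _
  · intro w w' h h'
    rw [map_mul]; exact h.mul_left h'

theorem prodHom_comp_inl (cs₁ : CoxeterSystem M₁ W₁) (cs₂ : CoxeterSystem M₂ W₂) :
    (prodHom cs₁ cs₂).comp (cs₁.prodInl M₂) = MonoidHom.inl W₁ W₂ :=
  cs₁.ext_simple fun i => by
    rw [MonoidHom.comp_apply, prodInl_simple, prodHom_inl, MonoidHom.inl_apply]

theorem prodHom_comp_inr (cs₁ : CoxeterSystem M₁ W₁) (cs₂ : CoxeterSystem M₂ W₂) :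
    (prodHom cs₁ cs₂).comp (prodInr M₁ cs₂) = MonoidHom.inr W₁ W₂ :=
  cs₂.ext_simple fun i => by
    rw [MonoidHom.comp_apply, prodInr_simple, prodHom_inr, MonoidHom.inr_apply]

/-- The product Coxeter system on `W₁ × W₂`, with simple reflections `S = S₁ ⊔ S₂`. -/
def prod (cs₁ : CoxeterSystem M₁ W₁) (cs₂ : CoxeterSystem M₂ W₂) :
    CoxeterSystem (M₁.prod M₂) (W₁ × W₂) where
  mulEquiv :=
    MonoidHom.toMulEquiv
      ((cs₁.prodInl M₂).noncommCoprod (prodInr M₁ cs₂) (prodInl_commute cs₁ cs₂))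
      (prodHom cs₁ cs₂)
      (by
        refine MonoidHom.ext fun w => ?_
        have h1 := DFunLike.congr_fun (prodHom_comp_inl cs₁ cs₂) w.1
        have h2 := DFunLike.congr_fun (prodHom_comp_inr cs₁ cs₂) w.2
        rw [MonoidHom.comp_apply] at h1 h2
        rw [MonoidHom.comp_apply, MonoidHom.noncommCoprod_apply, map_mul, h1, h2]
        simp)
      (by
        refine (M₁.prod M₂).toCoxeterSystem.ext_simple fun s => ?_
        rcases s with i | i
        · rw [MonoidHom.comp_apply, prodHom_inl, MonoidHom.noncommCoprod_apply, prodInl_simple,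
            map_one, mul_one, MonoidHom.id_apply]
        · rw [MonoidHom.comp_apply, prodHom_inr, MonoidHom.noncommCoprod_apply, prodInr_simple,
            map_one, one_mul, MonoidHom.id_apply])

theorem prod_simple_inl (cs₁ : CoxeterSystem M₁ W₁) (cs₂ : CoxeterSystem M₂ W₂) (i : B₁) :
    (cs₁.prod cs₂).simple (.inl i) = (cs₁.simple i, 1) :=
  (M₁.prod M₂).toCoxeterSystem.lift_apply_simple _ (.inl i)

theorem prod_simple_inr (cs₁ : CoxeterSystem M₁ W₁) (cs₂ : CoxeterSystem M₂ W₂) (j : B₂) :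
    (cs₁.prod cs₂).simple (.inr j) = (1, cs₂.simple j) :=
  (M₁.prod M₂).toCoxeterSystem.lift_apply_simple _ (.inr j)

end CoxeterSystem

/-! ### Gyoja's `W`-graph algebra -/

namespace WGraph

/-- `a b a ⋯` with `m` factors. -/
def altProd {R : Type*} [Monoid R] : ℕ → R → R → R
  | 0, _, _ => 1
  | m + 1, a, b => a * altProd m b a

/-- The braid commutator `a b a ⋯ - b a b ⋯` with `m` factors in each product. -/
def braidComm {R : Type*} [Ring R] (m : ℕ) (a b : R) : R :=
  altProd m a b - altProd m b a

/-- `-v⁻¹ e + v (1 - e) + x` in `A[v, v⁻¹]`. -/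
noncomputable def heckeGen {A : Type*} [Ring A] (e x : A) : LaurentPolynomial A :=
  -(LaurentPolynomial.T (-1) * LaurentPolynomial.C e)
    + LaurentPolynomial.T 1 * LaurentPolynomial.C (1 - e) + LaurentPolynomial.C x

/-- The free generators `e_s`, `x_s`. -/
inductive Gen (B : Type*) : Type _
  | e (s : B) : Gen B
  | x (s : B) : Gen B

/-- The free ring `ℤ⟨e_s, x_s⟩`. -/
abbrev GenRing (B : Type*) := FreeAlgebra ℤ (Gen B)

/-- `e_s` in the free ring. -/
def freeE {B : Type*} (s : B) : GenRing B := FreeAlgebra.ι ℤ (Gen.e s)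

/-- `x_s` in the free ring. -/
def freeX {B : Type*} (s : B) : GenRing B := FreeAlgebra.ι ℤ (Gen.x s)

/-- The coefficient `y^γ(s,t)` of `v^γ` in the braid commutator of `ι(T_s)` and `ι(T_t)`. If
`st` has infinite order, encoded by `M s t = 0`, this is zero and imposes no relation. -/
noncomputable def braidCoeff {B : Type*} (M : CoxeterMatrix B) (s t : B) (γ : ℤ) : GenRing B :=
  (braidComm (M s t) (heckeGen (freeE s) (freeX s)) (heckeGen (freeE t) (freeX t))).coeff γ

/-- The defining relations of the `W`-graph algebra. -/
inductive Rel {B : Type*} (M : CoxeterMatrix B) : GenRing B → GenRing B → Prop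
  | e_idem (s : B) : Rel M (freeE s * freeE s) (freeE s)
  | e_comm (s t : B) : Rel M (freeE s * freeE t) (freeE t * freeE s)
  | e_mul_x (s : B) : Rel M (freeE s * freeX s) (freeX s)
  | x_mul_e (s : B) : Rel M (freeX s * freeE s) 0
  | braid (s t : B) (γ : ℤ) : Rel M (braidCoeff M s t γ) 0

/-- The `W`-graph algebra `Ω(W,S)` over `ℤ`. -/
def Omega {B : Type*} (M : CoxeterMatrix B) : Type _ := RingQuot (Rel M)

noncomputable instance {B : Type*} (M : CoxeterMatrix B) : Ring (Omega M) :=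
  inferInstanceAs (Ring (RingQuot (Rel M)))

namespace Omega

variable {B : Type*} (M : CoxeterMatrix B)

/-- The quotient map `ℤ⟨e_s, x_s⟩ → Ω`. -/
noncomputable def mk : GenRing B →+* Omega M := RingQuot.mkRingHom (Rel M)

/-- The element `e_s` of `Ω`. -/
noncomputable def e (s : B) : Omega M := mk M (freeE s)

/-- The element `x_s` of `Ω`. -/
noncomputable def x (s : B) : Omega M := mk M (freeX s)

theorem mk_rel {a b : GenRing B} (h : Rel M a b) : mk M a = mk M b :=
  RingQuot.mkRingHom_rel h

theorem e_commute (s t : B) : Commute (e M s) (e M t) := by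
  have h := mk_rel M (Rel.e_comm s t)
  rwa [map_mul, map_mul] at h

theorem one_sub_e_commute (s t : B) : Commute (1 - e M s) (1 - e M t) :=
  ((Commute.one_left _).sub_left
    ((Commute.one_right _).sub_right (e_commute M s t)))

/-- `E_I = (∏_{t ∈ I} e_t) (∏_{t ∈ S \ I} (1 - e_t))`. -/
noncomputable def E [Fintype B] [DecidableEq B] (I : Finset B) : Omega M :=
  I.noncommProd (e M) (fun s _ t _ _ => e_commute M s t) *
    Iᶜ.noncommProd (fun t => 1 - e M t) (fun s _ t _ _ => one_sub_e_commute M s t)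

/-- `X^s_{IJ} = E_I x_s E_J`. -/
noncomputable def X [Fintype B] [DecidableEq B] (I J : Finset B) (s : B) : Omega M :=
  E M I * x M s * E M J

end Omega

/-- The edge `I ← J` of the compatibility graph: `I \ J` is nonempty, and no element of `I \ J`
commutes with an element of `J \ I`. -/
def Edge {B : Type*} [DecidableEq B] (M : CoxeterMatrix B) (I J : Finset B) : Prop :=
  (I \ J).Nonempty ∧ ∀ s ∈ I \ J, ∀ t ∈ J \ I, M s t ≠ 2

/-- `I ← J` is a transversal edge, that is, an edge with `J \ I` nonempty. -/
def Transversal {B : Type*} [DecidableEq B] (M : CoxeterMatrix B) (I J : Finset B) : Prop :=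
  Edge M I J ∧ (J \ I).Nonempty

/-- The subalgebra `Ψ(W,S)` of `Ω(W,S)` generated by all `E_I` and all transversal edge elements
`X_{IJ} = X^s_{IJ}`, `s ∈ I \ J`. -/
noncomputable def Psi {B : Type*} [Fintype B] [DecidableEq B] (M : CoxeterMatrix B) : Subalgebra ℤ (Omega M) :=
  Algebra.adjoin ℤ
    ({a | ∃ I : Finset B, a = Omega.E M I} ∪
      {a | ∃ I J : Finset B, Transversal M I J ∧ ∃ s ∈ I \ J, a = Omega.X M I J s})

theorem altProd_map {R R' : Type*} [Ring R] [Ring R'] (f : R →+* R') (m : ℕ) (a b : R) :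
    f (altProd m a b) = altProd m (f a) (f b) := by
  induction m generalizing a b with
  | zero => exact map_one f
  | succ m ih => rw [altProd, altProd, map_mul, ih]

theorem braidComm_map {R R' : Type*} [Ring R] [Ring R'] (f : R →+* R') (m : ℕ) (a b : R) :
    f (braidComm m a b) = braidComm m (f a) (f b) := by
  rw [braidComm, braidComm, map_sub, altProd_map, altProd_map]

theorem heckeGen_map {A A' : Type*} [Ring A] [Ring A'] (f : A →+* A') (e x : A) :
    AddMonoidAlgebra.mapRingHom ℤ f (heckeGen e x) = heckeGen (f e) (f x) := by
  have hC : ∀ a : A, AddMonoidAlgebra.mapRingHom ℤ f (LaurentPolynomial.C a) =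
      LaurentPolynomial.C (f a) := fun a => by
    rw [← LaurentPolynomial.single_eq_C, ← LaurentPolynomial.single_eq_C]
    exact AddMonoidAlgebra.mapRingHom_single _ _ _
  have hT : ∀ n : ℤ, AddMonoidAlgebra.mapRingHom ℤ f (LaurentPolynomial.T n) =
      LaurentPolynomial.T n := fun n => by
    unfold LaurentPolynomial.T
    rw [AddMonoidAlgebra.mapRingHom_single, map_one]
  simp only [heckeGen, map_add, map_neg, map_mul, hC, hT, map_sub, map_one]

theorem braidCoeff_map {B A : Type*} [Ring A] (M : CoxeterMatrix B) (f : GenRing B →+* A)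
    (s t : B) (γ : ℤ) :
    f (braidCoeff M s t γ) =
      (braidComm (M s t) (heckeGen (f (freeE s)) (f (freeX s)))
        (heckeGen (f (freeE t)) (f (freeX t)))).coeff γ := by
  rw [← heckeGen_map, ← heckeGen_map, ← braidComm_map]
  simp [braidCoeff]

/-- The parabolic morphism `Ω(W_J, J) → Ω(W, S)`, `e_s ↦ e_s`, `x_s ↦ x_s`, for a map
`f : J → S` that preserves the Coxeter matrices. -/
noncomputable def Omega.parabolic {B B' : Type*} (M : CoxeterMatrix B) (M' : CoxeterMatrix B')
    (f : B → B') (hf : ∀ s t, M' (f s) (f t) = M s t) : Omega M →+* Omega M' :=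
  RingQuot.lift
    ⟨((FreeAlgebra.lift ℤ fun g : Gen B => match g with
        | .e s => Omega.e M' (f s)
        | .x s => Omega.x M' (f s) : GenRing B →ₐ[ℤ] Omega M') : GenRing B →+* Omega M'), by
      set φ : GenRing B →+* Omega M' :=
        ((FreeAlgebra.lift ℤ fun g : Gen B => match g with
          | .e s => Omega.e M' (f s)
          | .x s => Omega.x M' (f s) : GenRing B →ₐ[ℤ] Omega M') : GenRing B →+* Omega M')
        with hφ
      have he : ∀ s, φ (freeE s) = Omega.mk M' (freeE (f s)) := fun s =>
        FreeAlgebra.lift_ι_apply _ _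
      have hx : ∀ s, φ (freeX s) = Omega.mk M' (freeX (f s)) := fun s =>
        FreeAlgebra.lift_ι_apply _ _
      intro a b h
      cases h with
      | e_idem s => rw [map_mul, he, ← map_mul, Omega.mk_rel M' (Rel.e_idem (f s))]
      | e_comm s t =>
        rw [map_mul, map_mul, he, he, ← map_mul, ← map_mul,
          Omega.mk_rel M' (Rel.e_comm (f s) (f t))]
      | e_mul_x s => rw [map_mul, he, hx, ← map_mul, Omega.mk_rel M' (Rel.e_mul_x (f s))]
      | x_mul_e s =>
        rw [map_mul, he, hx, ← map_mul, Omega.mk_rel M' (Rel.x_mul_e (f s)), map_zero, map_zero]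
      | braid s t γ =>
        rw [braidCoeff_map, he, he, hx, hx, ← hf s t, ← braidCoeff_map,
          Omega.mk_rel M' (Rel.braid (f s) (f t) γ), map_zero, map_zero]⟩

theorem Omega.parabolic_e {B B' : Type*} (M : CoxeterMatrix B) (M' : CoxeterMatrix B')
    (f : B → B') (hf : ∀ s t, M' (f s) (f t) = M s t) (s : B) :
    Omega.parabolic M M' f hf (Omega.e M s) = Omega.e M' (f s) := by
  unfold Omega.parabolic Omega.e Omega.mk
  refine (RingQuot.lift_mkRingHom_apply _ _ _).trans ?_
  exact FreeAlgebra.lift_ι_apply _ _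

theorem Omega.parabolic_x {B B' : Type*} (M : CoxeterMatrix B) (M' : CoxeterMatrix B')
    (f : B → B') (hf : ∀ s t, M' (f s) (f t) = M s t) (s : B) :
    Omega.parabolic M M' f hf (Omega.x M s) = Omega.x M' (f s) := by
  unfold Omega.parabolic Omega.x Omega.mk
  refine (RingQuot.lift_mkRingHom_apply _ _ _).trans ?_
  exact FreeAlgebra.lift_ι_apply _ _

/-! ### Scalar extension to `k` -/

section Scalars

variable (k : Type*) [CommRing k]

/-- `kΩ = k ⊗_ℤ Ω`. -/
abbrev KOmega {B : Type*} (M : CoxeterMatrix B) := k ⊗[ℤ] Omega M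

/-- The image of an element of `Ω` in `kΩ`. -/
noncomputable def toK {B : Type*} {M : CoxeterMatrix B} (a : Omega M) : KOmega k M := 1 ⊗ₜ[ℤ] a

/-- The subalgebra `kΨ` of `kΩ`. -/
noncomputable def KPsi {B : Type*} [Fintype B] [DecidableEq B] (M : CoxeterMatrix B) :
    Subalgebra k (KOmega k M) :=
  (Psi M).baseChange k

/-- The parabolic morphism `ι₁ : kΩ(W₁, S₁) → kΩ(W, S)`. -/
noncomputable def iota₁ {B₁ B₂ : Type*} (M₁ : CoxeterMatrix B₁) (M₂ : CoxeterMatrix B₂) :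
    KOmega k M₁ →ₐ[k] KOmega k (M₁.prod M₂) :=
  Algebra.TensorProduct.map (AlgHom.id k k)
    (Omega.parabolic M₁ (M₁.prod M₂) Sum.inl fun _ _ => rfl).toIntAlgHom

/-- The parabolic morphism `ι₂ : kΩ(W₂, S₂) → kΩ(W, S)`. -/
noncomputable def iota₂ {B₁ B₂ : Type*} (M₁ : CoxeterMatrix B₁) (M₂ : CoxeterMatrix B₂) :
    KOmega k M₂ →ₐ[k] KOmega k (M₁.prod M₂) :=
  Algebra.TensorProduct.map (AlgHom.id k k)
    (Omega.parabolic M₂ (M₁.prod M₂) Sum.inr fun _ _ => rfl).toIntAlgHom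

end Scalars

/-! ### Irreducible characters -/

/-- The set `Irr(W)` of irreducible complex characters of `W`. -/
def Irr (W : Type*) [Group W] : Type _ :=
  {χ : W → ℂ // ∃ (d : ℕ) (ρ : Representation ℂ W (Fin d → ℂ)),
    ρ.IsIrreducible ∧ ρ.character = χ}

namespace Irr

variable {W : Type*} [Group W]

instance : CoeFun (Irr W) fun _ => W → ℂ := ⟨Subtype.val⟩

/-- The degree `d_χ` of the character `χ`. -/
noncomputable def degree (χ : Irr W) : ℕ := χ.2.choose

theorem exists_rep (χ : Irr W) : ∃ ρ : Representation ℂ W (Fin χ.degree → ℂ),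
    ρ.IsIrreducible ∧ ρ.character = (χ : W → ℂ) :=
  χ.2.choose_spec

theorem degree_eq (χ : Irr W) : (χ.degree : ℂ) = χ 1 := by
  obtain ⟨ρ, -, h⟩ := χ.exists_rep
  rw [← h, Representation.char_one]
  simp

theorem orthonormal [Fintype W] [DecidableEq (Irr W)] (χ ψ : Irr W) :
    (Nat.card W : ℂ)⁻¹ * ∑ g : W, χ g * ψ g⁻¹ = if χ = ψ then 1 else 0 := by
  obtain ⟨ρ, hρ, h⟩ := χ.exists_rep
  obtain ⟨σ, hσ, h'⟩ := ψ.exists_rep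
  have hW : (Nat.card W : ℂ) ≠ 0 := by exact_mod_cast Nat.card_pos.ne'
  let _ : Invertible (Nat.card W : ℂ) := invertibleOfNonzero hW
  by_cases he : χ = ψ
  · subst he
    have := Representation.char_orthonormal ρ ρ
    rw [if_pos ⟨Representation.Equiv.refl ρ⟩, h] at this
    rw [if_pos rfl, this]
  · have := Representation.char_orthonormal ρ σ
    rw [if_neg, h, h'] at this
    · rw [if_neg he, this]
    · rintro ⟨φ⟩
      exact he (Subtype.ext (by rw [← h, ← h', Representation.char_iso φ]))

instance [Finite W] : Finite (Irr W) := by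
  classical
  have := Fintype.ofFinite W
  have hli : LinearIndependent ℂ (fun χ : Irr W => (χ : W → ℂ)) := by
    rw [linearIndependent_iff']
    intro s c hc ψ hψ
    have h1 : ∀ g, ∑ χ ∈ s, c χ * χ g = 0 := fun g => by
      have := congrFun hc g
      simpa using this
    have h2 : ∑ χ ∈ s, c χ * ((Nat.card W : ℂ)⁻¹ * ∑ g : W, χ g * ψ g⁻¹) = 0 := by
      calc _ = (Nat.card W : ℂ)⁻¹ * ∑ g : W, (∑ χ ∈ s, c χ * χ g) * ψ g⁻¹ := by
            simp_rw [Finset.sum_mul, Finset.mul_sum]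
            rw [Finset.sum_comm]
            refine Finset.sum_congr rfl fun _ _ => Finset.sum_congr rfl fun _ _ => ?_
            ring
        _ = 0 := by simp [h1]
    simp_rw [orthonormal] at h2
    simpa [hψ] using h2
  exact hli.finite

noncomputable instance [Finite W] : Fintype (Irr W) := Fintype.ofFinite _

end Irr

/-! ### The strong decomposition conjecture -/

/-- The subring `k` of `ℂ` is a good ring for the Coxeter group with matrix `M`. -/
def IsGoodRing {B : Type*} (k : Subring ℂ) (M : CoxeterMatrix B) : Prop :=
  ∀ s t : B, ((2 * Real.cos (2 * Real.pi / M s t) : ℝ) : ℂ) ∈ k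

/-- The elements `F^χ` of `kΩ` and the relation `≼` on `Irr(W)` satisfy the conditions (Z1)-(Z6) of
the strong `W`-graph decomposition conjecture. -/
structure IsStrongDecomposition (k : Type*) [CommRing k] {B : Type*} [Fintype B] [DecidableEq B]
    {M : CoxeterMatrix B} {W : Type*} [Group W] [Finite W] (_cs : CoxeterSystem M W)
    (F : Irr W → KOmega k M) (le : Irr W → Irr W → Prop) : Prop where
  idem : ∀ χ, F χ * F χ = F χ
  orth : ∀ χ ψ, χ ≠ ψ → F χ * F ψ = 0
  sum_eq_one : ∑ χ, F χ = 1
  comm : ∀ χ I, toK k (Omega.E M I) * F χ = F χ * toK k (Omega.E M I)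
  le_refl : ∀ χ, le χ χ
  le_trans : ∀ χ ψ θ, le χ ψ → le ψ θ → le χ θ
  le_antisymm : ∀ χ ψ, le χ ψ → le ψ χ → χ = ψ
  le_of_ne_zero : ∀ χ ψ, (∃ a : KOmega k M, F χ * a * F ψ ≠ 0) → le χ ψ
  /-- A surjective morphism of `k`-algebras from `k^{d × d}` onto `F^χ kΩ F^χ`, whose unit
  is `F^χ`. -/
  exists_surj : ∀ χ, ∃ ψ : Matrix (Fin χ.degree) (Fin χ.degree) k →ₙₐ[k] KOmega k M,
    ψ 1 = F χ ∧ Set.range ψ = {b | ∃ a : KOmega k M, b = F χ * a * F χ}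
  edge_mem : ∀ χ I J, Edge M I J → ∀ s ∈ I \ J,
    F χ * toK k (Omega.X M I J s) * F χ ∈ KPsi k M
  mem_psi : ∀ χ, F χ ∈ KPsi k M

/-- The strong `W`-graph decomposition conjecture for `(W,S)` over `k`. -/
def StrongDecompositionConjecture (k : Type*) [CommRing k] {B : Type*} [Fintype B] [DecidableEq B]
    {M : CoxeterMatrix B} {W : Type*} [Group W] [Finite W] (cs : CoxeterSystem M W) : Prop :=
  ∃ (F : Irr W → KOmega k M) (le : Irr W → Irr W → Prop), IsStrongDecomposition k cs F le

end WGraph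

/-! ### Finite Coxeter groups have finite Coxeter matrix entries -/

namespace CoxeterMatrix

variable {B : Type*} [Fintype B] [DecidableEq B] (M : CoxeterMatrix B)

/-! The images of `kΩ₁` and `kΩ₂` generate `kΩ`, but the relations do not hand over that they
commute: for `s ∈ S₁`, `t ∈ S₂` the braid relation of length 2 gives only `x_s x_t = x_t x_s` and
`[e_s, x_t] = [e_t, x_s]`. The proof lives on a smaller pair of subalgebras that do commute.
Compressing the bracket relation gives `(1 - e_t) x_s e_t = 0` across the factors, and from this the
algebras `descAlg`, generated by the `e_s` and the `(1 - e_w) x_t e_w` of one factor, centralize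
each other (`CrossRel.descAlg_commute`). For a transversal edge some `w ∈ J \ I` exists, so `X_{IJ}`
contains such an element and `kΨ_i ⊆ descAlg` (`KPsi_le_descAlg`). By (Z6) all `F^λ` and `F^μ` then
commute with each other, which yields (Z1) and (Z2); (Z6) follows because `kΨ_i` maps into `kΨ`.

For (Z3), commutators of `a ∈ descAlg` with the other factor are controlled: `[a, x_s] = [e_s, g]`
with `g` in the factor of `a` (`CrossRel.exists_bracket`). Sandwiching between `F^μ` and `F^ν` moves
`e_s` outside and leaves `F^μ g F^ν`, to which (Z3) of the factor applies. Elements that are block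
triangular for a transitive relation form an algebra, so generators suffice.

For (Z4), triangularity makes `a ↦ F a F` multiplicative, so a corner is generated by the corners of
generators. In each factor (Z5) and (Z6) put the whole corner into `kΨ_i`
(`IsStrongDecomposition.corner_mem_KPsi`). Hence the two matrix algebra images commute and combine
to a Kronecker product mapping onto the corner. For (Z5), an edge element with `s ∈ S₁` is an edge
element of the first factor between two idempotents `E_K`, `E_L` of the second.

Finiteness of `W` enters also through `m_{st} < ∞`, taken from the geometric representation: the
braid relation in degree `m - 1` makes `X^s_{IJ}` independent of `s`, and then `X^s_{IJ} = 0` off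
the edges. The bijection of characters is the classical one by outer tensor products. -/

/-- The functional `v ↦ 2 ⟨α_s, v⟩` for the canonical bilinear form
`⟨α_s, α_t⟩ = -cos (π / m_{st})`; an infinite order is encoded by `m_{st} = 0` and gives `-1`. -/
noncomputable def geomCoroot (s : B) : Module.Dual ℝ (B → ℝ) :=
  ∑ t, (-2 * Real.cos (Real.pi / M s t)) • LinearMap.proj t

theorem geomCoroot_single (s t : B) :
    M.geomCoroot s (Pi.single t 1) = -2 * Real.cos (Real.pi / M s t) := by
  simp [geomCoroot, Pi.single_apply]

theorem geomCoroot_self (s : B) : M.geomCoroot s (Pi.single s 1) = 2 := by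
  simp [geomCoroot_single]

/-- The reflection in the `s`-th simple root of the geometric representation. -/
noncomputable def geomReflection (s : B) : (B → ℝ) ≃ₗ[ℝ] (B → ℝ) :=
  Module.reflection (M.geomCoroot_self s)

open Polynomial.Chebyshev in
-- The product of two simple reflections behaves as a rotation by `2π / m`; its powers are expressed
-- by Chebyshev polynomials `S` at `2 cos (2π / m)`, whose values are quotients of sines.
theorem geomReflection_isLiftable : M.IsLiftable M.geomReflection := by
  intro s t
  by_cases hst : s = t
  · subst hst
    rw [M.diagonal, pow_one]
    ext1 v
    exact Module.involutive_reflection (M.geomCoroot_self s) v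
  have h1 : M s t ≠ 1 := M.off_diagonal s t hst
  set m := M s t with hm
  have hts : M t s = m := M.symmetric t s
  have hf : M.geomCoroot s (Pi.single t 1) = -2 * Real.cos (Real.pi / m) := M.geomCoroot_single s t
  have hg : M.geomCoroot t (Pi.single s 1) = -2 * Real.cos (Real.pi / m) := by
    rw [M.geomCoroot_single, hts]
  rcases Nat.eq_zero_or_pos m with h0 | hpos
  · rw [h0, pow_zero]
  set θ : ℝ := 2 * Real.pi / m with hθ
  have hT : 2 * Real.cos θ =
      M.geomCoroot s (Pi.single t 1) * M.geomCoroot t (Pi.single s 1) - 2 := by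
    rw [hf, hg, hθ, mul_div_assoc, Real.cos_two_mul]; ring
  have hm0 : (m : ℝ) ≠ 0 := by exact_mod_cast hpos.ne'
  ext1 v
  have key := Module.reflection_mul_reflection_pow_apply (M.geomCoroot_self s)
    (M.geomCoroot_self t) m v (2 * Real.cos θ) hT
  refine key.trans ?_
  rw [LinearEquiv.coe_one, id]
  -- Here `θ = π` and `sin θ = 0`, so the quotient of sines is unavailable; the two roots are
  -- orthogonal and the formula is evaluated directly.
  by_cases h2 : m = 2
  · have hc : Real.cos (Real.pi / (2 : ℕ)) = 0 := by norm_num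
    have hc' : Real.cos θ = -1 := by
      rw [hθ, h2]; norm_num
    rw [h2] at hf hg ⊢
    rw [hc] at hf hg
    rw [hf, hg, hc']
    norm_num
    module
  have h3 : 3 ≤ m := by omega
  have hsin : Real.sin θ ≠ 0 := by
    refine (Real.sin_pos_of_pos_of_lt_pi ?_ ?_).ne'
    · positivity
    · rw [hθ, div_lt_iff₀ (by positivity)]
      have : (3 : ℝ) ≤ m := by exact_mod_cast h3
      nlinarith [Real.pi_pos]
  have hS : ∀ n : ℤ, (S ℝ n).eval (2 * Real.cos θ) = Real.sin ((n + 1) * θ) / Real.sin θ :=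
    fun n => by rw [eq_div_iff hsin]; exact S_two_mul_real_cos θ n
  -- The integer divisions by 2 in the indices depend on parity. If `m = 2j`, then `jθ = π` and
  -- `S_{j-1}` vanishes; if `m = 2j + 1`, then `(j + 1)θ = 2π - jθ` and `S_j + S_{j-1}` vanishes.
  rcases Nat.even_or_odd' m with ⟨j, hj | hj⟩
  · have e1 : ((m : ℤ) - 2) / 2 = j - 1 := by omega
    have e2 : ((m : ℤ) - 1) / 2 = j - 1 := by omega
    have h0 : (S ℝ ((j : ℤ) - 1)).eval (2 * Real.cos θ) = 0 := by
      rw [hS]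
      have : (((j : ℤ) - 1 : ℤ) + 1 : ℝ) * θ = Real.pi := by
        have hmj : (m : ℝ) = 2 * j := by exact_mod_cast hj
        have : (j : ℝ) ≠ 0 := fun h => hm0 (by rw [hmj, h, mul_zero])
        rw [hθ, hmj]; push_cast; field_simp; ring
      rw [this, Real.sin_pi, zero_div]
    rw [e1, e2, h0]
    simp
  · have e1 : ((m : ℤ) - 2) / 2 = j - 1 := by omega
    have e2 : ((m : ℤ) - 1) / 2 = j := by omega
    have e3 : ((m : ℤ) - 3) / 2 = j - 1 := by omega
    have e4 : (m : ℤ) / 2 = j := by omega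
    have h0 : (S ℝ (j : ℤ)).eval (2 * Real.cos θ) +
        (S ℝ ((j : ℤ) - 1)).eval (2 * Real.cos θ) = 0 := by
      rw [hS, hS, ← add_div]
      have : (((j : ℤ) : ℝ) + 1) * θ = 2 * Real.pi - (((j : ℤ) - 1 : ℤ) + 1 : ℝ) * θ := by
        have hmj : (m : ℝ) = 2 * j + 1 := by exact_mod_cast hj
        have : (2 * j + 1 : ℝ) ≠ 0 := by positivity
        rw [hθ, hmj]; push_cast; field_simp; ring
      rw [this, Real.sin_two_pi_sub, neg_add_cancel, zero_div]
    rw [e1, e2, e3, e4, h0]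
    simp

end CoxeterMatrix

open Polynomial.Chebyshev in
/-- In a finite Coxeter group every product of two simple reflections has a nonzero exponent
in the Coxeter matrix. -/
theorem CoxeterSystem.matrix_ne_zero {B W : Type*} [Fintype B] [Group W] [Finite W]
    {M : CoxeterMatrix B} (cs : CoxeterSystem M W) (s t : B) : M s t ≠ 0 := by
  classical
  intro h0
  have hst : s ≠ t := by
    rintro rfl
    rw [M.diagonal] at h0
    exact one_ne_zero h0
  have hts : M t s = 0 := (M.symmetric t s).trans h0
  have hf : M.geomCoroot s (Pi.single t 1) = -2 := by simp [M.geomCoroot_single, h0]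
  have hg : M.geomCoroot t (Pi.single s 1) = -2 := by simp [M.geomCoroot_single, hts]
  obtain ⟨n, hn, hpow⟩ := isOfFinOrder_iff_pow_eq_one.mp
    (isOfFinOrder_of_finite (cs.simple s * cs.simple t))
  have h1 := congrArg (cs.lift ⟨_, M.geomReflection_isLiftable⟩) hpow
  rw [map_pow, map_mul, cs.lift_apply_simple, cs.lift_apply_simple, map_one] at h1
  -- With both pairings equal to `-2` the parameter is `4 - 2 = 2`, where `S_{n-1}` takes the value
  -- `n`. The `α_t`-coordinate of `(r_s r_t)^n α_s` is thus `2n`, which cannot vanish.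
  have h2 := Module.reflection_mul_reflection_pow_apply_self (M.geomCoroot_self s)
    (M.geomCoroot_self t) n 2 (by rw [hf, hg]; norm_num)
  have h3 := LinearEquiv.congr_fun h1 (Pi.single s 1)
  have h4 := congrFun (h2.symm.trans h3) t
  rw [hg] at h4
  simp [hst.symm] at h4
  omega

/-! ### Coefficients of the braid relations -/

namespace WGraph

variable {A : Type*} [Ring A]

/-- The relations satisfied by a pair `e = e_s`, `x = x_s` of generators. -/
structure IsGenPair (e x : A) : Prop where
  idem : e * e = e
  e_mul_x : e * x = x
  x_mul_e : x * e = 0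

theorem IsGenPair.map {A' : Type*} [Ring A'] {e x : A} (h : IsGenPair e x) (φ : A →+* A') :
    IsGenPair (φ e) (φ x) where
  idem := by rw [← map_mul, h.idem]
  e_mul_x := by rw [← map_mul, h.e_mul_x]
  x_mul_e := by rw [← map_mul, h.x_mul_e, map_zero]

theorem coeff_heckeGen_mul (e x : A) (p : LaurentPolynomial A) (γ : ℤ) :
    (heckeGen e x * p).coeff γ =
      -(e * p.coeff (γ + 1)) + (1 - e) * p.coeff (γ - 1) + x * p.coeff γ := by
  have hT : ∀ (n : ℤ) (a : A), (LaurentPolynomial.T n * LaurentPolynomial.C a * p).coeff γ =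
      a * p.coeff (γ - n) := fun n a => by
    rw [(LaurentPolynomial.commute_T n _).eq, ← LaurentPolynomial.single_eq_C_mul_T,
      AddMonoidAlgebra.coeff_single_mul_apply, sub_eq_neg_add]
  have hC : ∀ a : A, (LaurentPolynomial.C a * p).coeff γ = a * p.coeff γ := fun a => by
    have := hT 0 a
    rwa [LaurentPolynomial.T_zero, one_mul, sub_zero] at this
  rw [heckeGen, add_mul, add_mul, neg_mul]
  simp only [AddMonoidAlgebra.coeff_add, AddMonoidAlgebra.coeff_neg, Finsupp.add_apply,
    Finsupp.neg_apply, hT, hC, sub_neg_eq_add]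

theorem coeff_altProd_of_lt (n : ℕ) (e x e' x' : A) (γ : ℤ) (h : (n : ℤ) < γ) :
    (altProd n (heckeGen e x) (heckeGen e' x')).coeff γ = 0 := by
  induction n generalizing e x e' x' γ with
  | zero =>
    rw [altProd, AddMonoidAlgebra.one_def, AddMonoidAlgebra.coeff_single, Finsupp.single_apply,
      if_neg]
    push_cast at h
    omega
  | succ n ih =>
    push_cast at h
    rw [altProd, coeff_heckeGen_mul, ih _ _ _ _ _ (by omega), ih _ _ _ _ _ (by omega),
      ih _ _ _ _ _ (by omega)]
    simp

theorem coeff_altProd_succ_self (n : ℕ) (e x e' x' : A) :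
    (altProd (n + 1) (heckeGen e x) (heckeGen e' x')).coeff ((n + 1 : ℕ) : ℤ) =
      (1 - e) * (altProd n (heckeGen e' x') (heckeGen e x)).coeff (n : ℤ) := by
  rw [altProd, coeff_heckeGen_mul, coeff_altProd_of_lt _ _ _ _ _ _ (by push_cast; omega),
    coeff_altProd_of_lt n _ _ _ _ ((n + 1 : ℕ) : ℤ) (by push_cast; omega)]
  simp

theorem coeff_altProd_succ_pred (n : ℕ) (e x e' x' : A) :
    (altProd (n + 1) (heckeGen e x) (heckeGen e' x')).coeff (n : ℤ) =
      (1 - e) * (altProd n (heckeGen e' x') (heckeGen e x)).coeff ((n : ℤ) - 1) +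
        x * (altProd n (heckeGen e' x') (heckeGen e x)).coeff (n : ℤ) := by
  rw [altProd, coeff_heckeGen_mul, coeff_altProd_of_lt _ _ _ _ _ _ (by omega)]
  simp

theorem coeff_altProd_zero_self (a b : LaurentPolynomial A) :
    (altProd 0 a b).coeff 0 = 1 := by
  rw [altProd, AddMonoidAlgebra.one_def, AddMonoidAlgebra.coeff_single, Finsupp.single_apply,
      if_pos rfl]

theorem coeff_altProd_zero_of_ne (a b : LaurentPolynomial A) {γ : ℤ} (h : γ ≠ 0) :
    (altProd 0 a b).coeff γ = 0 := by
  rw [altProd, AddMonoidAlgebra.one_def, AddMonoidAlgebra.coeff_single, Finsupp.single_apply,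
      if_neg h.symm]

theorem IsGenPair.one_sub_mul_self {e x : A} (h : IsGenPair e x) : (1 - e) * x = 0 := by
  rw [sub_mul, one_mul, h.e_mul_x, sub_self]

theorem IsGenPair.mul_one_sub {e x : A} (h : IsGenPair e x) : x * (1 - e) = x := by
  rw [mul_sub, mul_one, h.x_mul_e, sub_zero]

theorem IsGenPair.one_sub_idem {e x : A} (h : IsGenPair e x) : (1 - e) * (1 - e) = 1 - e := by
  rw [mul_sub, mul_one, sub_mul, one_mul, h.idem, sub_self, sub_zero]

theorem IsGenPair.one_sub_mul_e {e x : A} (h : IsGenPair e x) : (1 - e) * e = 0 := by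
  rw [sub_mul, one_mul, h.idem, sub_self]

theorem IsGenPair.e_mul_one_sub {e x : A} (h : IsGenPair e x) : e * (1 - e) = 0 := by
  rw [mul_sub, mul_one, h.idem, sub_self]

theorem commute_one_sub {e e' : A} (h : Commute e e') : Commute (1 - e) (1 - e') :=
  (Commute.one_left _).sub_left ((Commute.one_right _).sub_right h)

/-- The top coefficient is an alternating product of the commuting idempotents `1 - e` and `1 - e'`;
from `n = 2` on both occur and it no longer changes. -/
theorem coeff_altProd_self {e x e' x' : A} (h : IsGenPair e x) (h' : IsGenPair e' x')
    (hee : Commute e e') (n : ℕ) (hn : 2 ≤ n) :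
    (altProd n (heckeGen e x) (heckeGen e' x')).coeff (n : ℤ) = (1 - e) * (1 - e') := by
  induction n, hn using Nat.le_induction generalizing e x e' x' with
  | base =>
    have h0 := coeff_altProd_zero_self (heckeGen e x) (heckeGen e' x')
    have h1 := coeff_altProd_succ_self 0 e' x' e x
    have h2 := coeff_altProd_succ_self 1 e x e' x'
    rw [h2, h1, Nat.cast_zero, h0, mul_one]
  | succ n hn ih =>
    rw [coeff_altProd_succ_self, ih h' h hee.symm, ← mul_assoc, (commute_one_sub hee).eq,
      mul_assoc, h.one_sub_idem]

/-- In degree `n - 1` exactly one factor contributes its `x` or `x'`. Since `(1 - e) x = 0`, such a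
factor survives only in the first or second place; later it is preceded by both idempotents.
Multiplying by `(1 - e)(1 - e')` on the right makes the answer uniform in `n ≥ 2`. -/
theorem coeff_altProd_pred {e x e' x' : A} (h : IsGenPair e x) (h' : IsGenPair e' x')
    (hee : Commute e e') (n : ℕ) (hn : 2 ≤ n) :
    (altProd n (heckeGen e x) (heckeGen e' x')).coeff ((n : ℤ) - 1) * ((1 - e) * (1 - e')) =
      x * (1 - e') + (1 - e) * x' * (1 - e) := by
  have hc := (commute_one_sub hee).eq
  have hx : x * ((1 - e) * (1 - e')) = x * (1 - e') := by rw [← mul_assoc, h.mul_one_sub]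
  induction n, hn using Nat.le_induction generalizing e x e' x' with
  | base =>
    have hx' : x' * ((1 - e) * (1 - e')) = x' * (1 - e) := by
      rw [hc, ← mul_assoc, h'.mul_one_sub]
    have h0 := coeff_altProd_zero_self (heckeGen e x) (heckeGen e' x')
    have h0' := coeff_altProd_zero_of_ne (heckeGen e x) (heckeGen e' x') (γ := -1) (by omega)
    have h1 := coeff_altProd_succ_self 0 e' x' e x
    have h1' := coeff_altProd_succ_pred 0 e' x' e x
    have h2 := coeff_altProd_succ_pred 1 e x e' x'
    norm_num at h0 h0' h1 h1' h2 ⊢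
    rw [h2, h1, h1', h0, h0', mul_zero, zero_add, mul_one, mul_one, add_mul, mul_assoc,
      mul_assoc x, hx', hc, ← mul_assoc (1 - e') (1 - e'), h'.one_sub_idem, ← hc, hx, add_comm,
      mul_assoc]
  | succ n hn ih =>
    have key := ih h' h hee.symm hc.symm (by rw [← mul_assoc, h'.mul_one_sub])
    rw [Nat.cast_succ, add_sub_cancel_right, coeff_altProd_succ_pred,
      coeff_altProd_self h' h hee.symm n hn, add_mul, mul_assoc, hc, key, ← hc]
    have h1 : (1 - e) * (x' * (1 - e) + (1 - e') * x * (1 - e')) = (1 - e) * x' * (1 - e) := by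
      rw [mul_add, ← mul_assoc, ← mul_assoc, ← mul_assoc, hc, mul_assoc (1 - e') _ x,
        h.one_sub_mul_self, mul_zero, zero_mul, add_zero]
    have h2 : x * ((1 - e) * (1 - e')) * ((1 - e) * (1 - e')) = x * (1 - e') := by
      rw [hx, mul_assoc, hc, ← mul_assoc (1 - e') (1 - e'), h'.one_sub_idem, ← hc, hx]
    rw [h1, h2, add_comm]

/-- The coefficient of `v ^ (m - 1)` in the braid relation: for `e = e_s`, `e' = e_t`, it says that
`E_I x_s E_J = E_I x_t E_J` for `s, t ∈ I \ J`. -/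
theorem exchange_of_braidComm {e x e' x' : A} (h : IsGenPair e x) (h' : IsGenPair e' x')
    (hee : Commute e e') (m : ℕ) (hm : 2 ≤ m)
    (hb : ∀ γ, (braidComm m (heckeGen e x) (heckeGen e' x')).coeff γ = 0) :
    e' * x * (1 - e') = e * x' * (1 - e) := by
  have h1 := hb (m - 1)
  rw [braidComm, AddMonoidAlgebra.coeff_sub, Finsupp.sub_apply, sub_eq_zero] at h1
  have h2 := coeff_altProd_pred h h' hee m hm
  have h3 := coeff_altProd_pred h' h hee.symm m hm
  rw [(commute_one_sub hee).eq, h1, h3] at h2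
  have : e' * x * (1 - e') - e * x' * (1 - e) =
      (x * (1 - e') + (1 - e) * x' * (1 - e)) - (x' * (1 - e) + (1 - e') * x * (1 - e')) := by
    noncomm_ring
  rw [← sub_eq_zero, this, ← h2, sub_self]

/-- For `m = 2` the coefficient of `v⁰` gives the commutation of `x` and `x'`, that of `v⁻¹` the
bracket identity. -/
theorem commutator_of_braidComm {e x e' x' : A} (hee : Commute e e')
    (hb : ∀ γ, (braidComm 2 (heckeGen e x) (heckeGen e' x')).coeff γ = 0) :
    x * x' = x' * x ∧ e * x' - x' * e = e' * x - x * e' := by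
  have h := fun e x e' x' : A => fun γ => show
    (altProd 2 (heckeGen e x) (heckeGen e' x')).coeff γ = _ by
      rw [altProd, altProd, altProd]
  simp only [coeff_heckeGen_mul, AddMonoidAlgebra.one_def, AddMonoidAlgebra.coeff_single,
    Finsupp.single_apply] at h
  have h0 := hb 0
  have h1 := hb (-1)
  rw [braidComm, AddMonoidAlgebra.coeff_sub, Finsupp.sub_apply, h, h] at h0 h1
  norm_num at h0 h1
  constructor
  · rw [← sub_eq_zero, ← h0]
    have := hee.eq
    noncomm_ring
    rw [this]
    abel
  · rw [← sub_eq_zero, ← neg_eq_zero, ← h1]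
    abel

end WGraph

/-! ### Two families of generators with the commutation relations of a product -/

namespace WGraph

/-- Families `e_s, x_s` (`s ∈ S₁`) and `e_t, x_t` (`t ∈ S₂`) that satisfy the relations of the
`W`-graph algebra between commuting generators. -/
structure CrossRel {A S₁ S₂ : Type*} [Ring A] (e₁ x₁ : S₁ → A) (e₂ x₂ : S₂ → A) : Prop where
  pair₁ : ∀ s, IsGenPair (e₁ s) (x₁ s)
  pair₂ : ∀ t, IsGenPair (e₂ t) (x₂ t)
  e_comm₁ : ∀ s t, Commute (e₁ s) (e₁ t)
  e_comm₂ : ∀ s t, Commute (e₂ s) (e₂ t)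
  e_comm : ∀ s t, Commute (e₁ s) (e₂ t)
  x_comm : ∀ s t, Commute (x₁ s) (x₂ t)
  bracket : ∀ s t, e₁ s * x₂ t - x₂ t * e₁ s = e₂ t * x₁ s - x₁ s * e₂ t

/-- The element `(1 - e_w) x_t e_w`. -/
def descElt {A S : Type*} [Ring A] (e x : S → A) (w t : S) : A := (1 - e w) * x t * e w

namespace CrossRel

variable {A S₁ S₂ : Type*} [Ring A] {e₁ x₁ : S₁ → A} {e₂ x₂ : S₂ → A}

theorem symm (c : CrossRel e₁ x₁ e₂ x₂) : CrossRel e₂ x₂ e₁ x₁ where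
  pair₁ := c.pair₂
  pair₂ := c.pair₁
  e_comm₁ := c.e_comm₂
  e_comm₂ := c.e_comm₁
  e_comm s t := (c.e_comm t s).symm
  x_comm s t := (c.x_comm t s).symm
  bracket s t := (c.bracket t s).symm

/-- Compressing the bracket relation between `1 - e_t` and `e_t` kills the side with `x_t`, because
`(1 - e_t) x_t = 0`. -/
theorem one_sub_mul_x_mul_e (c : CrossRel e₁ x₁ e₂ x₂) (s : S₁) (t : S₂) :
    (1 - e₂ t) * x₁ s * e₂ t = 0 := by
  have h := congrArg (fun a => (1 - e₂ t) * a * e₂ t) (c.bracket s t)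
  have h1 : (1 - e₂ t) * (e₁ s * x₂ t - x₂ t * e₁ s) * e₂ t = 0 := by
    have hc : (1 - e₂ t) * e₁ s = e₁ s * (1 - e₂ t) :=
      ((Commute.one_left _).sub_left (c.e_comm s t).symm).eq
    rw [mul_sub, sub_mul, ← mul_assoc, hc, mul_assoc (e₁ s), (c.pair₂ t).one_sub_mul_self,
      ← mul_assoc, (c.pair₂ t).one_sub_mul_self]
    simp
  have h2 : (1 - e₂ t) * (e₂ t * x₁ s - x₁ s * e₂ t) * e₂ t = -((1 - e₂ t) * x₁ s * e₂ t) := by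
    rw [mul_sub, sub_mul, ← mul_assoc, (c.pair₂ t).one_sub_mul_e, ← mul_assoc, mul_assoc _ (e₂ t),
      (c.pair₂ t).idem]
    simp
  simp only [h1, h2] at h
  exact neg_eq_zero.mp h.symm

/-- Compress `[e_u, x_t] = [e_t, x_u]` between `1 - e_w` and `e_w`: the right side becomes the
commutator of `e_t` with `(1 - e_w) x_u e_w = 0`. -/
theorem descElt_commute_e (c : CrossRel e₁ x₁ e₂ x₂) (w t : S₂) (u : S₁) :
    Commute (descElt e₂ x₂ w t) (e₁ u) := by
  have h0 := c.one_sub_mul_x_mul_e u w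
  have h1 := (c.e_comm u w).eq
  have h2 := (c.e_comm₂ t w).eq
  have h3 := c.bracket u t
  refine Eq.symm ?_
  unfold descElt
  -- The correction terms of the rearrangement all contain a factor `(1 - e_w) x_v e_w` or its
  -- analogue with `x_s`, which vanishes.
  -- A noncommutative certificate: the difference of the two sides is the displayed sum of left and
  -- right multiples of the hypotheses. The same device is used below.
  linear_combination (norm := noncomm_ring) (1 - e₂ w) * h3 * e₂ w - h1 * (x₂ t * e₂ w)
    + (1 - e₂ w) * x₂ t * h1 + e₂ t * h0 - h0 * e₂ t + h2 * (x₁ u * e₂ w) - (1 - e₂ w) * x₁ u * h2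

theorem descElt_mul_descElt (c : CrossRel e₁ x₁ e₂ x₂) (v s : S₁) (w t : S₂) :
    descElt e₂ x₂ w t * descElt e₁ x₁ v s =
      (1 - e₁ v) * (1 - e₂ w) * (x₂ t * x₁ s) * (e₁ v * e₂ w) := by
  have hR := (c.symm.descElt_commute_e v s w).eq
  have h1 : descElt e₂ x₂ w t * descElt e₁ x₁ v s =
      (1 - e₂ w) * x₂ t * descElt e₁ x₁ v s * e₂ w := by
    rw [descElt.eq_def e₂, mul_assoc _ (e₂ w), ← hR, ← mul_assoc]
  have h0 := c.one_sub_mul_x_mul_e s w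
  have h0' := c.one_sub_mul_x_mul_e v w
  have h2 := (c.e_comm v w).eq
  have h3 := c.bracket v t
  have h4 := (c.e_comm₂ t w).eq
  rw [h1]
  unfold descElt
  linear_combination (norm := noncomm_ring) -h2 * (x₂ t * x₁ s * e₁ v * e₂ w)
    + (1 - e₂ w) * h3 * (x₁ s * e₁ v * e₂ w) + h4 * (x₁ v * x₁ s * e₁ v * e₂ w)
    + e₂ t * h0' * (x₁ s * e₁ v * e₂ w) + e₂ t * (1 - e₂ w) * x₁ v * h0 * e₁ v
    + e₂ t * (1 - e₂ w) * x₁ v * (1 - e₂ w) * x₁ s * h2 - h0' * (e₂ t * x₁ s * e₁ v * e₂ w)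
    - (1 - e₂ w) * x₁ v * h4 * (x₁ s * e₁ v * e₂ w) - (1 - e₂ w) * x₁ v * e₂ t * h0 * e₁ v
    - (1 - e₂ w) * x₁ v * e₂ t * (1 - e₂ w) * x₁ s * h2

/-- The normal form of the product is symmetric in the two factors once `x_s` and `x_t` are
interchanged. -/
theorem descElt_commute_descElt (c : CrossRel e₁ x₁ e₂ x₂) (v s : S₁) (w t : S₂) :
    Commute (descElt e₁ x₁ v s) (descElt e₂ x₂ w t) := by
  refine Eq.symm ?_
  rw [c.descElt_mul_descElt, c.symm.descElt_mul_descElt, (c.x_comm s t).eq, (c.e_comm v w).eq,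
    (commute_one_sub (c.e_comm v w)).eq]

/-- Write `y = (1 - e_w) x_t e_w`. As `x_s` commutes with `x_t`, only `[e_w, x_s] = [e_s, x_w]`
contributes to `[y, x_s]`. Using `e_w x_w = x_w`, `x_w (1 - e_w) = x_w` and `[e_s, y] = 0`, the
result collects to `[e_s, [y, x_w]]`. -/
theorem bracket_descElt (c : CrossRel e₁ x₁ e₂ x₂) (s : S₁) (w t : S₂) :
    descElt e₂ x₂ w t * x₁ s - x₁ s * descElt e₂ x₂ w t =
      e₁ s * (descElt e₂ x₂ w t * x₂ w - x₂ w * descElt e₂ x₂ w t) -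
        (descElt e₂ x₂ w t * x₂ w - x₂ w * descElt e₂ x₂ w t) * e₁ s := by
  have h1 := (c.descElt_commute_e w t s).eq
  have h2 := c.bracket s w
  have h3 := (c.x_comm s t).eq
  have h5 := (c.pair₂ w).e_mul_x
  have h6 := (c.e_comm s w).eq
  have h7 := (c.pair₂ w).x_mul_e
  unfold descElt at h1 ⊢
  linear_combination (norm := noncomm_ring) -((1 - e₂ w) * x₂ t * h2) + h2 * x₂ t * e₂ w
    - (1 - e₂ w) * h3 * e₂ w - (1 - e₂ w) * x₂ t * e₁ s * h5 + (1 - e₂ w) * x₂ t * h6 * x₂ w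
    + h1 * x₂ w + (1 - e₂ w) * x₂ t * h5 * e₁ s - e₁ s * h7 * x₂ t * e₂ w
    + h7 * e₁ s * x₂ t * e₂ w + x₂ w * h6 * x₂ t * e₂ w - x₂ w * h1

end CrossRel
/-! ### The subalgebra generated by the elements `e_s` and `(1 - e_w) x_t e_w` -/

section Subalgebras

variable (k : Type*) {A S : Type*} [CommRing k] [Ring A] [Algebra k A]

/-- The subalgebra generated by the `e_s` and `x_s`. -/
def genAlg (e x : S → A) : Subalgebra k A := Algebra.adjoin k (Set.range e ∪ Set.range x)

/-- The subalgebra generated by the `e_s` and `(1 - e_w) x_t e_w`. -/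
def descAlg (e x : S → A) : Subalgebra k A :=
  Algebra.adjoin k (Set.range e ∪ {a | ∃ w t, a = descElt e x w t})

variable {k} {e x : S → A}

theorem e_mem_genAlg (s : S) : e s ∈ genAlg k e x := Algebra.subset_adjoin (.inl ⟨s, rfl⟩)

theorem x_mem_genAlg (s : S) : x s ∈ genAlg k e x := Algebra.subset_adjoin (.inr ⟨s, rfl⟩)

theorem e_mem_descAlg (s : S) : e s ∈ descAlg k e x := Algebra.subset_adjoin (.inl ⟨s, rfl⟩)

theorem descElt_mem_descAlg (w t : S) : descElt e x w t ∈ descAlg k e x :=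
  Algebra.subset_adjoin (.inr ⟨w, t, rfl⟩)

theorem descElt_mem_genAlg (w t : S) : descElt e x w t ∈ genAlg k e x :=
  mul_mem (mul_mem (sub_mem (one_mem _) (e_mem_genAlg w)) (x_mem_genAlg t)) (e_mem_genAlg w)

theorem descAlg_le_genAlg : descAlg k e x ≤ genAlg k e x := by
  refine Algebra.adjoin_le ?_
  rintro _ (⟨s, rfl⟩ | ⟨w, t, rfl⟩)
  · exact e_mem_genAlg s
  · exact descElt_mem_genAlg w t

theorem genAlg_map {A' : Type*} [Ring A'] [Algebra k A'] (φ : A →ₐ[k] A') :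
    (genAlg k e x).map φ = genAlg k (fun s => φ (e s)) (fun s => φ (x s)) := by
  rw [genAlg, AlgHom.map_adjoin, Set.image_union, ← Set.range_comp, ← Set.range_comp]
  rfl

theorem map_mem_descAlg {A' : Type*} [Ring A'] [Algebra k A'] (φ : A →ₐ[k] A') {a : A}
    (ha : a ∈ descAlg k e x) : φ a ∈ descAlg k (fun s => φ (e s)) (fun s => φ (x s)) := by
  suffices h : descAlg k e x ≤ (descAlg k (fun s => φ (e s)) (fun s => φ (x s))).comap φ from h ha
  refine Algebra.adjoin_le ?_
  rintro _ (⟨s, rfl⟩ | ⟨w, t, rfl⟩)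
  · exact e_mem_descAlg (e := fun s => φ (e s)) s
  · have := descElt_mem_descAlg (k := k) (e := fun s => φ (e s)) (x := fun s => φ (x s)) w t
    simpa [descElt] using this

namespace CrossRel

variable {S₁ S₂ : Type*} {e₁ x₁ : S₁ → A} {e₂ x₂ : S₂ → A}

theorem descAlg_commute (c : CrossRel e₁ x₁ e₂ x₂) {a b : A} (ha : a ∈ descAlg k e₁ x₁)
    (hb : b ∈ descAlg k e₂ x₂) : Commute a b := by
  induction ha using Algebra.adjoin_induction with
  | algebraMap r => exact Algebra.commutes r b
  | add _ _ _ _ h h' => exact h.add_left h'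
  | mul _ _ _ _ h h' => exact h.mul_left h'
  | mem a ha =>
    induction hb using Algebra.adjoin_induction with
    | algebraMap r => exact (Algebra.commutes r a).symm
    | add _ _ _ _ h h' => exact h.add_right h'
    | mul _ _ _ _ h h' => exact h.mul_right h'
    | mem b hb =>
      obtain (⟨s, rfl⟩ | ⟨v, s, rfl⟩) := ha <;> obtain (⟨t, rfl⟩ | ⟨w, t, rfl⟩) := hb
      · exact c.e_comm s t
      · exact (c.descElt_commute_e w t s).symm
      · exact c.symm.descElt_commute_e v s t
      · exact c.descElt_commute_descElt v s w t

theorem e_commute_of_mem_descAlg (c : CrossRel e₁ x₁ e₂ x₂) (s : S₁) {b : A}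
    (hb : b ∈ descAlg k e₂ x₂) : Commute (e₁ s) b :=
  c.descAlg_commute (k := k) (e_mem_descAlg s) hb

/-- The property passes to products by the Leibniz rule: `a g' + g b` works for `a b`, because `e_s`
commutes with `a` and `b`. The witness `g` is only claimed to lie in `genAlg`, which is enough for
(Z3). -/
theorem exists_bracket (c : CrossRel e₁ x₁ e₂ x₂) (s : S₁) {a : A} (ha : a ∈ descAlg k e₂ x₂) :
    ∃ g ∈ genAlg k e₂ x₂, a * x₁ s - x₁ s * a = e₁ s * g - g * e₁ s := by
  induction ha using Algebra.adjoin_induction with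
  | algebraMap r => exact ⟨0, zero_mem _, by rw [Algebra.commutes]; simp⟩
  | add a b _ _ h h' =>
    obtain ⟨g, hg, h⟩ := h
    obtain ⟨g', hg', h'⟩ := h'
    refine ⟨g + g', add_mem hg hg', ?_⟩
    linear_combination (norm := noncomm_ring) h + h'
  | mul a b ha hb h h' =>
    obtain ⟨g, hg, h⟩ := h
    obtain ⟨g', hg', h'⟩ := h'
    have hca := (c.e_commute_of_mem_descAlg s ha).eq
    have hcb := (c.e_commute_of_mem_descAlg s hb).eq
    refine ⟨a * g' + g * b, add_mem (mul_mem (descAlg_le_genAlg ha) hg')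
      (mul_mem hg (descAlg_le_genAlg hb)), ?_⟩
    linear_combination (norm := noncomm_ring) h * b + a * h' - hca * g' - g * hcb
  | mem a ha =>
    obtain (⟨t, rfl⟩ | ⟨w, t, rfl⟩) := ha
    · exact ⟨x₂ t, x_mem_genAlg t, (c.bracket s t).symm⟩
    · exact ⟨_, sub_mem (mul_mem (descElt_mem_genAlg w t) (x_mem_genAlg w))
        (mul_mem (x_mem_genAlg w) (descElt_mem_genAlg w t)), c.bracket_descElt s w t⟩

end CrossRel

end Subalgebras

/-! ### Block triangular algebras -/

section Blocks

variable {k A ι : Type*} [CommRing k] [Ring A] [Algebra k A] [Fintype ι]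

/-- A complete family of orthogonal idempotents. -/
structure IsCompleteOrth (F : ι → A) : Prop where
  idem : ∀ i, F i * F i = F i
  orth : ∀ i j, i ≠ j → F i * F j = 0
  sum_eq_one : ∑ i, F i = 1

theorem IsCompleteOrth.mul_mul_mul {F : ι → A} (hF : IsCompleteOrth F) (i j : ι) (a b : A) :
    F i * (a * b) * F j = ∑ l, (F i * a * F l) * (F l * b * F j) := by
  calc F i * (a * b) * F j = F i * a * (∑ l, F l) * b * F j := by
        rw [hF.sum_eq_one, mul_one]; simp only [mul_assoc]
    _ = _ := by
        rw [Finset.mul_sum, Finset.sum_mul, Finset.sum_mul]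
        refine Finset.sum_congr rfl fun l _ => ?_
        conv_lhs => rw [← hF.idem l]
        simp only [mul_assoc]

variable (k) in
/-- The subalgebra of those `a` for which `F i * a * F j` vanishes unless `i ≼ j`. -/
def blockTriangular {F : ι → A} (hF : IsCompleteOrth F) {le : ι → ι → Prop}
    (hrefl : ∀ i, le i i) (htrans : ∀ i j l, le i j → le j l → le i l) : Subalgebra k A where
  carrier := {a | ∀ i j, F i * a * F j ≠ 0 → le i j}
  mul_mem' := fun {a b} ha hb i j h => by
    rw [hF.mul_mul_mul] at h
    obtain ⟨l, -, hl⟩ := Finset.exists_ne_zero_of_sum_ne_zero h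
    exact htrans i l j (ha i l (left_ne_zero_of_mul hl)) (hb l j (right_ne_zero_of_mul hl))
  add_mem' := fun {a b} ha hb i j h => by
    by_contra hle
    rw [mul_add, add_mul, not_imp_comm.mp (ha i j) hle, not_imp_comm.mp (hb i j) hle,
      add_zero] at h
    exact h rfl
  algebraMap_mem' := fun r i j h => by
    by_cases hij : i = j
    · exact hij ▸ hrefl i
    · rw [← Algebra.commutes, mul_assoc, hF.orth i j hij, mul_zero] at h
      exact absurd rfl h

/-- After inserting `1 = ∑ F l`, a surviving term has `i ≼ l ≼ i`, so `l = i` by antisymmetry. -/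
theorem IsCompleteOrth.corner_mul {F : ι → A} (hF : IsCompleteOrth F) {le : ι → ι → Prop}
    (hanti : ∀ i j, le i j → le j i → i = j) (hle : ∀ i j a, F i * a * F j ≠ 0 → le i j)
    (i : ι) (a b : A) : F i * (a * b) * F i = (F i * a * F i) * (F i * b * F i) := by
  rw [hF.mul_mul_mul]
  refine Finset.sum_eq_single i (fun l _ hl => ?_) fun h => absurd (Finset.mem_univ i) h
  by_contra h
  exact hl (hanti l i (hle l i b (right_ne_zero_of_mul h)) (hle i l a (left_ne_zero_of_mul h)))

/-- If `F i * A * F j` vanishes unless `i ≼ j`, then the corner `F i * A * F i` is generated by the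
images of generators of `A`. -/
theorem IsCompleteOrth.corner_mem {F : ι → A} (hF : IsCompleteOrth F) {le : ι → ι → Prop}
    (hanti : ∀ i j, le i j → le j i → i = j) (hle : ∀ i j a, F i * a * F j ≠ 0 → le i j)
    {s : Set A} (i : ι) (C : NonUnitalSubalgebra k A) (h1 : F i ∈ C)
    (hs : ∀ a ∈ s, F i * a * F i ∈ C) {a : A} (ha : a ∈ Algebra.adjoin k s) :
    F i * a * F i ∈ C := by
  induction ha using Algebra.adjoin_induction with
  | mem a ha => exact hs a ha
  | algebraMap r =>
    rw [← Algebra.commutes, mul_assoc, hF.idem, ← Algebra.smul_def]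
    exact SMulMemClass.smul_mem r h1
  | add a b _ _ h h' => rw [mul_add, add_mul]; exact add_mem h h'
  | mul a b _ _ h h' => rw [hF.corner_mul hanti hle]; exact mul_mem h h'

end Blocks

/-! ### Commuting images of matrix algebras -/

section Kronecker

variable {k A : Type*} [CommRing k] [Ring A] [Algebra k A]
  {m n : Type*} [Fintype m] [DecidableEq m] [Fintype n] [DecidableEq n]

/-- Two algebra morphisms from matrix algebras with commuting images combine to a morphism from the
algebra of matrices of the product size. -/
theorem exists_kronecker_hom {p : Type*} [Fintype p] [DecidableEq p] (ε : m × n ≃ p)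
    (φ : Matrix m m k →ₙₐ[k] A) (ψ : Matrix n n k →ₙₐ[k] A) (hc : ∀ a b, Commute (φ a) (ψ b)) :
    ∃ θ : Matrix p p k →ₙₐ[k] A, θ 1 = φ 1 * ψ 1 ∧ ∀ a b, φ a * ψ b ∈ Set.range θ := by
  let l : Matrix m m k ⊗[k] Matrix n n k →ₗ[k] A :=
    TensorProduct.lift ((LinearMap.mul k A).compl₁₂ (φ : Matrix m m k →ₗ[k] A) ψ)
  have hl : ∀ a b, l (a ⊗ₜ b) = φ a * ψ b := fun a b => TensorProduct.lift.tmul _ _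
  have hmul : ∀ p q, l (p * q) = l p * l q := by
    intro p q
    induction p using TensorProduct.induction_on with
    | zero => simp
    | add p p' h h' => rw [add_mul, map_add, map_add, add_mul, h, h']
    | tmul a b =>
      induction q using TensorProduct.induction_on with
      | zero => simp
      | add p p' h h' => rw [mul_add, map_add, map_add, mul_add, h, h']
      | tmul a' b' =>
        rw [Algebra.TensorProduct.tmul_mul_tmul, hl, hl, hl, map_mul, map_mul, mul_assoc,
          mul_assoc, ← mul_assoc (φ a'), ← mul_assoc (ψ b), (hc a' b).eq]
  let E : (Matrix m m k ⊗[k] Matrix n n k) ≃ₐ[k] Matrix p p k :=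
    (Matrix.kroneckerAlgEquiv m n k).trans (Matrix.reindexAlgEquiv k k ε)
  refine ⟨{ toFun := fun X => l (E.symm X)
            map_mul' := fun X Y => by rw [map_mul, hmul]
            map_smul' := fun r X => by rw [map_smul, map_smul]; rfl
            map_zero' := by rw [map_zero, map_zero]
            map_add' := fun X Y => by rw [map_add, map_add] }, ?_, fun a b => ⟨E (a ⊗ₜ b), ?_⟩⟩
  · refine Eq.trans ?_ (hl 1 1)
    exact congrArg l (map_one E.symm)
  · refine Eq.trans ?_ (hl a b)
    exact congrArg l (E.symm_apply_apply _)

end Kronecker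

/-! ### Relations in the `W`-graph algebra -/

namespace Omega

variable {B : Type*} (M : CoxeterMatrix B)

theorem isGenPair (s : B) : IsGenPair (e M s) (x M s) where
  idem := by have h := mk_rel M (Rel.e_idem s); rwa [map_mul] at h
  e_mul_x := by have h := mk_rel M (Rel.e_mul_x s); rwa [map_mul] at h
  x_mul_e := by have h := mk_rel M (Rel.x_mul_e s); rwa [map_mul, map_zero] at h

theorem braidComm_coeff (s t : B) (γ : ℤ) :
    (braidComm (M s t) (heckeGen (e M s) (x M s)) (heckeGen (e M t) (x M t))).coeff γ = 0 := by
  have h := mk_rel M (Rel.braid s t γ)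
  rwa [braidCoeff_map, map_zero] at h

theorem exchange {s t : B} (hst : s ≠ t) (h0 : M s t ≠ 0) :
    e M t * x M s * (1 - e M t) = e M s * x M t * (1 - e M s) := by
  have h1 := M.off_diagonal s t hst
  exact exchange_of_braidComm (isGenPair M s) (isGenPair M t) (e_commute M s t) (M s t) (by omega)
    (braidComm_coeff M s t)

theorem x_commute_and_bracket {s t : B} (h : M s t = 2) :
    x M s * x M t = x M t * x M s ∧
      e M s * x M t - x M t * e M s = e M t * x M s - x M s * e M t :=
  commutator_of_braidComm (e_commute M s t) (h ▸ braidComm_coeff M s t)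

theorem adjoin_eq_top : Algebra.adjoin ℤ (Set.range (e M) ∪ Set.range (x M)) = ⊤ := by
  rw [eq_top_iff]
  rintro a -
  obtain ⟨a, rfl⟩ : ∃ b, mk M b = a := RingQuot.mkRingHom_surjective (Rel M) a
  induction a using FreeAlgebra.induction with
  | grade0 r =>
    rw [eq_intCast (algebraMap ℤ (FreeAlgebra ℤ (Gen B))) r, map_intCast]
    exact intCast_mem _ r
  | grade1 g =>
    cases g with
    | e s => exact Algebra.subset_adjoin (.inl ⟨s, rfl⟩)
    | x s => exact Algebra.subset_adjoin (.inr ⟨s, rfl⟩)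
  | mul a b ha hb => rw [map_mul]; exact mul_mem ha hb
  | add a b ha hb => rw [map_add]; exact add_mem ha hb

theorem pairwise_e (I : Finset B) : (I : Set B).Pairwise (Function.onFun Commute (e M)) :=
  fun s _ t _ _ => e_commute M s t

theorem pairwise_one_sub_e (I : Finset B) :
    (I : Set B).Pairwise (Function.onFun Commute fun t => 1 - e M t) :=
  fun s _ t _ _ => one_sub_e_commute M s t

/-! ### The idempotents `E_I` and the elements `X_{IJ}` -/

section E

variable [Fintype B] [DecidableEq B]

theorem E_def (I : Finset B) : E M I = I.noncommProd (e M) (pairwise_e M I) *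
    Iᶜ.noncommProd (fun t => 1 - e M t) (pairwise_one_sub_e M Iᶜ) := rfl

theorem e_mul_E_of_mem {I : Finset B} {s : B} (h : s ∈ I) : e M s * E M I = E M I := by
  rw [E_def, ← mul_assoc, ← Finset.mul_noncommProd_erase I h, ← mul_assoc, (isGenPair M s).idem]

theorem e_mul_E_of_notMem {I : Finset B} {s : B} (h : s ∉ I) : e M s * E M I = 0 := by
  have hc : Commute (e M s) (I.noncommProd (e M) (pairwise_e M I)) :=
    Finset.noncommProd_commute _ _ _ _ fun t _ => e_commute M s t
  rw [E_def, ← mul_assoc, hc.eq, ← Finset.mul_noncommProd_erase Iᶜ (Finset.mem_compl.mpr h),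
    mul_assoc, ← mul_assoc (e M s), (isGenPair M s).e_mul_one_sub, zero_mul, mul_zero]

theorem commute_E {a : Omega M} (h : ∀ s, Commute a (e M s)) (I : Finset B) :
    Commute a (E M I) :=
  (Finset.noncommProd_commute _ _ _ _ fun t _ => h t).mul_right
    (Finset.noncommProd_commute _ _ _ _ fun t _ => (Commute.one_right _).sub_right (h t))

theorem E_mul_e_of_mem {I : Finset B} {s : B} (h : s ∈ I) : E M I * e M s = E M I := by
  rw [← (commute_E M (e_commute M s) I).eq, e_mul_E_of_mem M h]

theorem E_mul_e_of_notMem {I : Finset B} {s : B} (h : s ∉ I) : E M I * e M s = 0 := by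
  rw [← (commute_E M (e_commute M s) I).eq, e_mul_E_of_notMem M h]

theorem E_mem {R : Type*} [CommRing R] {A : Type*} [Ring A] [Algebra R A] (φ : Omega M →+* A)
    (C : Subalgebra R A) (h : ∀ s, φ (e M s) ∈ C) (I : Finset B) : φ (E M I) ∈ C := by
  rw [E_def, map_mul, Finset.map_noncommProd, Finset.map_noncommProd]
  refine mul_mem (Submonoid.noncommProd_mem C.toSubmonoid _ _ _ fun t _ => h t)
    (Submonoid.noncommProd_mem C.toSubmonoid _ _ _ fun t _ => ?_)
  rw [map_sub, map_one]
  exact (sub_mem (one_mem C) (h t) : 1 - φ (e M t) ∈ C)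

/-- Stated along a ring morphism so that it serves both inside `Ω` and for the `E_I` of a parabolic
factor. -/
theorem map_E_mul_eq_self {A : Type*} [Ring A] (φ : Omega M →+* A) {I : Finset B} {z : A}
    (h : ∀ s ∈ I, φ (e M s) * z = z) (h' : ∀ s ∉ I, φ (e M s) * z = 0) : φ (E M I) * z = z := by
  have hm : ∀ a b : A, a * z = z → b * z = z → a * b * z = z := fun a b ha hb => by
    rw [mul_assoc, hb, ha]
  rw [E_def, map_mul, Finset.map_noncommProd, Finset.map_noncommProd]
  refine hm _ _ (Finset.noncommProd_induction _ _ _ (fun a => a * z = z) hm (one_mul z) h)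
    (Finset.noncommProd_induction _ _ _ (fun a => a * z = z) hm (one_mul z) fun s hs => ?_)
  rw [map_sub, map_one, sub_mul, one_mul, h' s (Finset.mem_compl.mp hs), sub_zero]

theorem E_idem (I : Finset B) : E M I * E M I = E M I :=
  map_E_mul_eq_self M (RingHom.id _) (fun _ => e_mul_E_of_mem M) fun _ => e_mul_E_of_notMem M

/-- Expand `∏ (e_s + (1 - e_s)) = 1` in the commutative subalgebra generated by the `e_s`. -/
theorem sum_E : ∑ I, E M I = 1 := by
  let C := Algebra.adjoin ℤ (Set.range (e M))
  have hC : IsMulCommutative C := Algebra.isMulCommutative_adjoin ℤ (by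
    rintro _ ⟨s, rfl⟩ _ ⟨t, rfl⟩
    exact e_commute M s t)
  let _ : CommRing C := { (inferInstance : Ring C) with mul_comm := hC.is_comm.comm }
  let e' : B → C := fun s => ⟨e M s, Algebra.subset_adjoin ⟨s, rfl⟩⟩
  have hE : ∀ I, E M I = C.val ((∏ s ∈ I, e' s) * ∏ s ∈ Finset.univ \ I, (1 - e' s)) := fun I => by
    rw [map_mul, ← Finset.noncommProd_eq_prod, ← Finset.noncommProd_eq_prod]
    erw [Finset.map_noncommProd, Finset.map_noncommProd]
    rfl
  simp_rw [hE]
  rw [← map_sum]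
  have h := Finset.prod_add e' (fun s => 1 - e' s) Finset.univ
  rw [Finset.powerset_univ] at h
  rw [← h]
  simp

theorem e_eq_sum (s : B) : e M s = ∑ I with s ∈ I, E M I := by
  rw [← mul_one (e M s), ← sum_E M, Finset.mul_sum, Finset.sum_filter]
  refine Finset.sum_congr rfl fun I _ => ?_
  split_ifs with h
  · exact e_mul_E_of_mem M h
  · exact e_mul_E_of_notMem M h

theorem eq_sum_E_mul_mul_E (a : Omega M) : a = ∑ I, ∑ J, E M I * a * E M J := by
  simp_rw [← Finset.mul_sum, ← Finset.sum_mul, sum_E, one_mul, mul_one]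

theorem X_eq_zero_of_notMem_left {I J : Finset B} {s : B} (h : s ∉ I) : X M I J s = 0 := by
  rw [X, ← (isGenPair M s).e_mul_x, ← mul_assoc, E_mul_e_of_notMem M h, zero_mul, zero_mul]

theorem X_eq_zero_of_mem_right {I J : Finset B} {s : B} (h : s ∈ J) : X M I J s = 0 := by
  rw [X, ← e_mul_E_of_mem M h, mul_assoc, ← mul_assoc (x M s), (isGenPair M s).x_mul_e, zero_mul,
    mul_zero]

theorem one_sub_e_mul_E {I : Finset B} {s : B} (h : s ∉ I) : (1 - e M s) * E M I = E M I := by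
  rw [sub_mul, one_mul, e_mul_E_of_notMem M h, sub_zero]

theorem E_mul_one_sub_e {I : Finset B} {s : B} (h : s ∉ I) : E M I * (1 - e M s) = E M I := by
  rw [mul_sub, mul_one, E_mul_e_of_notMem M h, sub_zero]

/-- `X^s_{IJ}` does not depend on `s ∈ I \ J`. -/
theorem X_eq_X {I J : Finset B} {s t : B} (h0 : M s t ≠ 0) (hs : s ∈ I \ J) (ht : t ∈ I \ J) :
    X M I J s = X M I J t := by
  rcases eq_or_ne s t with rfl | hst
  · rfl
  rw [Finset.mem_sdiff] at hs ht
  have h := congrArg (fun a => E M I * a * E M J) (exchange M hst h0)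
  simp only [← mul_assoc, E_mul_e_of_mem M hs.1, E_mul_e_of_mem M ht.1] at h
  rwa [mul_assoc _ (1 - e M t), mul_assoc _ (1 - e M s), one_sub_e_mul_E M ht.2,
    one_sub_e_mul_E M hs.2] at h

/-- Between `E_I` and `E_J` the bracket relation reads `X^t_{IJ} = -X^s_{IJ}`, and the left side
vanishes since `t ∉ I`. -/
theorem X_eq_zero_of_commuting {I J : Finset B} {s t : B} (hs : s ∈ I \ J) (ht : t ∈ J \ I)
    (h : M s t = 2) : X M I J s = 0 := by
  rw [Finset.mem_sdiff] at hs ht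
  have h1 := congrArg (fun a => E M I * a * E M J) (x_commute_and_bracket M h).2
  have h2 : E M I * (e M s * x M t - x M t * e M s) * E M J = X M I J t := by
    rw [mul_sub, sub_mul, ← mul_assoc, E_mul_e_of_mem M hs.1, ← mul_assoc, mul_assoc _ (e M s),
      e_mul_E_of_notMem M hs.2, mul_zero, sub_zero, X]
  have h3 : E M I * (e M t * x M s - x M s * e M t) * E M J = - X M I J s := by
    rw [mul_sub, sub_mul, ← mul_assoc, E_mul_e_of_notMem M ht.2, ← mul_assoc, mul_assoc _ (e M t),
      e_mul_E_of_mem M ht.1, zero_mul, zero_mul, zero_sub, X]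
  simp only [h2, h3, X_eq_zero_of_notMem_left M ht.2] at h1
  exact (neg_eq_zero.mp h1.symm)

theorem X_eq_zero_of_not_edge (h0 : ∀ s t, M s t ≠ 0) {I J : Finset B} {s : B} (hs : s ∈ I \ J)
    (hE : ¬ Edge M I J) : X M I J s = 0 := by
  have h : ∃ u ∈ I \ J, ∃ t ∈ J \ I, M u t = 2 := by
    by_contra! hc
    exact hE ⟨⟨s, hs⟩, hc⟩
  obtain ⟨u, hu, t, ht, hut⟩ := h
  -- The given `s` need not commute with `t`; independence of `s` replaces it by `u`, which does.
  rw [X_eq_X M (h0 s u) hs hu, X_eq_zero_of_commuting M hu ht hut]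

/-- A transversal edge element lies between an element `(1 - e_w) x_s e_w`. -/
theorem X_eq_E_mul_descElt_mul_E {I J : Finset B} {s w : B} (hw : w ∈ J \ I) :
    X M I J s = E M I * descElt (e M) (x M) w s * E M J := by
  rw [Finset.mem_sdiff] at hw
  rw [descElt, ← mul_assoc, ← mul_assoc, E_mul_one_sub_e M hw.2, mul_assoc _ (e M w),
    e_mul_E_of_mem M hw.1, X]

end E

end Omega

/-! ### Scalar extension -/

section Scalars

variable (k : Type*) [CommRing k] {B : Type*} (M : CoxeterMatrix B)

/-- The ring morphism `Ω → kΩ`. -/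
noncomputable def toKHom : Omega M →+* KOmega k M :=
  (Algebra.TensorProduct.includeRight : Omega M →ₐ[ℤ] k ⊗[ℤ] Omega M)

variable {M} in
theorem toKHom_apply (a : Omega M) : toKHom k M a = toK k a := rfl

/-- The generator `e_s` of `kΩ`. -/
noncomputable def ke (s : B) : KOmega k M := toK k (Omega.e M s)

/-- The generator `x_s` of `kΩ`. -/
noncomputable def kx (s : B) : KOmega k M := toK k (Omega.x M s)

variable {k M}

theorem toK_mem_of_adjoin {A : Type*} [Ring A] [Algebra k A] (φ : KOmega k M →ₐ[k] A)
    (C : Subalgebra k A) {s : Set (Omega M)} (h : ∀ a ∈ s, φ (toK k a) ∈ C) {a : Omega M}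
    (ha : a ∈ Algebra.adjoin ℤ s) : φ (toK k a) ∈ C := by
  induction ha using Algebra.adjoin_induction with
  | mem a ha => exact h a ha
  | algebraMap r =>
    rw [← toKHom_apply, eq_intCast (algebraMap ℤ (Omega M)) r, map_intCast, map_intCast]
    exact intCast_mem C r
  | add a b _ _ ha hb =>
    rw [← toKHom_apply, map_add, map_add]
    exact add_mem ha hb
  | mul a b _ _ ha hb =>
    rw [← toKHom_apply, map_mul, map_mul]
    exact mul_mem ha hb

theorem tmul_eq_smul_toK (r : k) (a : Omega M) : r ⊗ₜ[ℤ] a = r • toK k a := by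
  rw [toK, TensorProduct.smul_tmul', smul_eq_mul, mul_one]

theorem genAlg_eq_top : genAlg k (ke k M) (kx k M) = ⊤ := by
  rw [eq_top_iff]
  rintro a -
  induction a using TensorProduct.induction_on with
  | zero => exact zero_mem _
  | add a b ha hb => exact add_mem ha hb
  | tmul r a =>
    rw [tmul_eq_smul_toK]
    refine Subalgebra.smul_mem _ (toK_mem_of_adjoin (AlgHom.id k _) _
      (s := Set.range (Omega.e M) ∪ Set.range (Omega.x M)) ?_ ?_) r
    · rintro _ (⟨s, rfl⟩ | ⟨s, rfl⟩)
      · exact e_mem_genAlg s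
      · exact x_mem_genAlg s
    · rw [Omega.adjoin_eq_top]; trivial

variable [Fintype B] [DecidableEq B]

theorem map_mem_of_mem_KPsi {A : Type*} [Ring A] [Algebra k A] (φ : KOmega k M →ₐ[k] A)
    (C : Subalgebra k A) (hE : ∀ s, φ (ke k M s) ∈ C)
    (hX : ∀ I J, Transversal M I J → ∀ s ∈ I \ J, φ (toK k (Omega.X M I J s)) ∈ C)
    {a : KOmega k M} (ha : a ∈ KPsi k M) : φ a ∈ C := by
  obtain ⟨b, rfl⟩ := ha
  induction b using TensorProduct.induction_on with
  | zero => rw [map_zero, map_zero]; exact zero_mem _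
  | add a b ha hb => rw [map_add, map_add]; exact add_mem ha hb
  | tmul r a =>
    have h : (Algebra.TensorProduct.map (AlgHom.id k k) (Psi M).val).toRingHom (r ⊗ₜ a) =
        r • toK k (a : Omega M) := tmul_eq_smul_toK r (a : Omega M)
    erw [h]
    rw [map_smul]
    refine Subalgebra.smul_mem _ (toK_mem_of_adjoin φ C ?_ a.2) r
    rintro _ (⟨I, rfl⟩ | ⟨I, J, hIJ, s, hs, rfl⟩)
    · exact Omega.E_mem M ((φ : KOmega k M →+* A).comp (toKHom k M)) C hE I
    · exact hX I J hIJ s hs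

theorem toK_mem_KPsi {a : Omega M} (ha : a ∈ Psi M) : toK k a ∈ KPsi k M :=
  Subalgebra.tmul_mem_baseChange ha 1

theorem Omega.e_mem_Psi (s : B) : Omega.e M s ∈ Psi M := by
  rw [Omega.e_eq_sum]
  exact sum_mem fun I _ => Algebra.subset_adjoin (.inl ⟨I, rfl⟩)

theorem ke_mem_KPsi (s : B) : ke k M s ∈ KPsi k M := toK_mem_KPsi (Omega.e_mem_Psi s)

theorem toK_E_mem_descAlg (I : Finset B) :
    toK k (Omega.E M I) ∈ descAlg k (ke k M) (kx k M) :=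
  Omega.E_mem M (toKHom k M) _ (fun s => e_mem_descAlg s) I

theorem KPsi_le_descAlg : KPsi k M ≤ descAlg k (ke k M) (kx k M) := by
  intro a ha
  refine map_mem_of_mem_KPsi (AlgHom.id k _) _
    (fun s => e_mem_descAlg (e := ke k M) (x := kx k M) s) ?_ ha
  rintro I J hIJ s -
  obtain ⟨w, hw⟩ := hIJ.2
  rw [AlgHom.id_apply, Omega.X_eq_E_mul_descElt_mul_E M hw, ← toKHom_apply, map_mul, map_mul]
  refine mul_mem (mul_mem (toK_E_mem_descAlg I) ?_) (toK_E_mem_descAlg J)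
  have h : toKHom k M (descElt (Omega.e M) (Omega.x M) w s) = descElt (ke k M) (kx k M) w s := by
    rw [descElt, map_mul, map_mul, map_sub, map_one]; rfl
  rw [h]
  exact descElt_mem_descAlg w s

variable (k) in
/-- The morphism `kΩ(W_J, J) → kΩ(W, S)` for a map `J → S` that preserves the Coxeter matrices. -/
noncomputable def kParabolic {B B' : Type*} (M : CoxeterMatrix B) (M' : CoxeterMatrix B')
    (f : B → B') (hf : ∀ s t, M' (f s) (f t) = M s t) : KOmega k M →ₐ[k] KOmega k M' :=
  Algebra.TensorProduct.map (AlgHom.id k k) (Omega.parabolic M M' f hf).toIntAlgHom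

section

variable {B B' : Type*} (M : CoxeterMatrix B) (M' : CoxeterMatrix B')
    (f : B → B') (hf : ∀ s t, M' (f s) (f t) = M s t)

theorem kParabolic_toK (a : Omega M) :
    kParabolic k M M' f hf (toK k a) = toK k (Omega.parabolic M M' f hf a) := by
  rw [toK, kParabolic, Algebra.TensorProduct.map_tmul, map_one]
  rfl

theorem kParabolic_ke (s : B) : kParabolic k M M' f hf (ke k M s) = ke k M' (f s) := by
  rw [ke, kParabolic_toK, Omega.parabolic_e, ke]

theorem kParabolic_kx (s : B) : kParabolic k M M' f hf (kx k M s) = kx k M' (f s) := by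
  rw [kx, kParabolic_toK, Omega.parabolic_x, kx]

end

end Scalars

/-! ### Corners of a strong decomposition -/

section Corners

variable {k : Type*} [CommRing k] {B : Type*} [Fintype B] [DecidableEq B] {M : CoxeterMatrix B}
  {W : Type*} [Group W] [Finite W] {cs : CoxeterSystem M W} {F : Irr W → KOmega k M}
  {le : Irr W → Irr W → Prop}

namespace IsStrongDecomposition

theorem isCompleteOrth (h : IsStrongDecomposition k cs F le) : IsCompleteOrth F :=
  ⟨h.idem, h.orth, h.sum_eq_one⟩

/-- By triangularity only `e_s` and `x_s` matter. Splitting `x_s` into the `X^s_{IJ}`, each term is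
covered by (Z5) or is zero. -/
theorem corner_mem_KPsi (h : IsStrongDecomposition k cs F le) (χ : Irr W) (a : KOmega k M) :
    F χ * a * F χ ∈ KPsi k M := by
  refine h.isCompleteOrth.corner_mem (k := k) h.le_antisymm
    (fun i j a ha => h.le_of_ne_zero i j ⟨a, ha⟩) χ (KPsi k M).toNonUnitalSubalgebra
    (h.mem_psi χ) (s := Set.range (ke k M) ∪ Set.range (kx k M)) ?_
    (show a ∈ genAlg k (ke k M) (kx k M) by rw [genAlg_eq_top]; trivial)
  rintro _ (⟨s, rfl⟩ | ⟨s, rfl⟩)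
  · exact mul_mem (mul_mem (h.mem_psi χ) (ke_mem_KPsi s)) (h.mem_psi χ)
  · rw [kx, Omega.eq_sum_E_mul_mul_E M (Omega.x M s), ← toKHom_apply, map_sum, Finset.mul_sum,
      Finset.sum_mul]
    refine sum_mem fun I _ => ?_
    rw [map_sum, Finset.mul_sum, Finset.sum_mul]
    refine sum_mem fun J _ => ?_
    change F χ * toK k (Omega.X M I J s) * F χ ∈ KPsi k M
    have h0 : Omega.X M I J s = 0 → F χ * toK k (Omega.X M I J s) * F χ ∈ KPsi k M := fun h0 => by
      rw [h0, ← toKHom_apply, map_zero, mul_zero, zero_mul]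
      exact zero_mem _
    by_cases hs : s ∈ I \ J
    · by_cases hE : Edge M I J
      · exact h.edge_mem χ I J hE s hs
      · exact h0 (Omega.X_eq_zero_of_not_edge M cs.matrix_ne_zero hs hE)
    · rw [Finset.mem_sdiff, not_and_or, not_not] at hs
      exact h0 (hs.elim (Omega.X_eq_zero_of_notMem_left M) (Omega.X_eq_zero_of_mem_right M))

end IsStrongDecomposition

end Corners

/-! ### Products of Coxeter matrices, symmetrically -/

theorem CrossRel.map {A A' S₁ S₂ : Type*} [Ring A] [Ring A'] {e₁ x₁ : S₁ → A} {e₂ x₂ : S₂ → A}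
    (c : CrossRel e₁ x₁ e₂ x₂) (φ : A →+* A') :
    CrossRel (fun s => φ (e₁ s)) (fun s => φ (x₁ s)) (fun t => φ (e₂ t)) (fun t => φ (x₂ t)) where
  pair₁ s := (c.pair₁ s).map φ
  pair₂ t := (c.pair₂ t).map φ
  e_comm₁ s t := (c.e_comm₁ s t).map φ
  e_comm₂ s t := (c.e_comm₂ s t).map φ
  e_comm s t := (c.e_comm s t).map φ
  x_comm s t := (c.x_comm s t).map φ
  bracket s t := by simp only [← map_mul, ← map_sub, c.bracket]

/-- The Coxeter matrix `M` is the product of `M₁` and `M₂` along the maps `i` and `j`. -/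
structure IsProd {B₁ B₂ B : Type*} (M₁ : CoxeterMatrix B₁) (M₂ : CoxeterMatrix B₂)
    (M : CoxeterMatrix B) (i : B₁ → B) (j : B₂ → B) : Prop where
  inj₁ : Function.Injective i
  inj₂ : Function.Injective j
  ne : ∀ s t, i s ≠ j t
  cover : ∀ b, (∃ s, i s = b) ∨ ∃ t, j t = b
  matrix₁ : ∀ s t, M (i s) (i t) = M₁ s t
  matrix₂ : ∀ s t, M (j s) (j t) = M₂ s t
  matrix : ∀ s t, M (i s) (j t) = 2

namespace IsProd

variable {B₁ B₂ B : Type*} {M₁ : CoxeterMatrix B₁} {M₂ : CoxeterMatrix B₂} {M : CoxeterMatrix B}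
  {i : B₁ → B} {j : B₂ → B}

/-- Lets each statement about one factor be reused for the other. -/
theorem symm (h : IsProd M₁ M₂ M i j) : IsProd M₂ M₁ M j i where
  inj₁ := h.inj₂
  inj₂ := h.inj₁
  ne s t := (h.ne t s).symm
  cover b := (h.cover b).symm
  matrix₁ := h.matrix₂
  matrix₂ := h.matrix₁
  matrix s t := (M.symmetric _ _).trans (h.matrix t s)

theorem crossRel (h : IsProd M₁ M₂ M i j) :
    CrossRel (fun s => Omega.e M (i s)) (fun s => Omega.x M (i s)) (fun t => Omega.e M (j t))
      (fun t => Omega.x M (j t)) where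
  pair₁ s := Omega.isGenPair M (i s)
  pair₂ t := Omega.isGenPair M (j t)
  e_comm₁ s t := Omega.e_commute M (i s) (i t)
  e_comm₂ s t := Omega.e_commute M (j s) (j t)
  e_comm s t := Omega.e_commute M (i s) (j t)
  x_comm s t := (Omega.x_commute_and_bracket M (h.matrix s t)).1
  bracket s t := (Omega.x_commute_and_bracket M (h.matrix s t)).2

theorem crossRel_k (h : IsProd M₁ M₂ M i j) (k : Type*) [CommRing k] :
    CrossRel (fun s => ke k M (i s)) (fun s => kx k M (i s)) (fun t => ke k M (j t))
      (fun t => kx k M (j t)) :=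
  h.crossRel.map (toKHom k M)

section Psi

variable [Fintype B₁] [DecidableEq B₁] [Fintype B₂] [DecidableEq B₂] [Fintype B] [DecidableEq B]

/-- The subset `I ∪ K` of `S₁ ⊔ S₂`. -/
def union (_h : IsProd M₁ M₂ M i j) (I : Finset B₁) (K : Finset B₂) : Finset B :=
  I.image i ∪ K.image j

theorem mem_union_left (h : IsProd M₁ M₂ M i j) {I : Finset B₁} {K : Finset B₂} {s : B₁} :
    i s ∈ h.union I K ↔ s ∈ I := by
  rw [union, Finset.mem_union, Finset.mem_image, Finset.mem_image]
  constructor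
  · rintro (⟨t, ht, hs⟩ | ⟨t, -, hs⟩)
    · exact h.inj₁ hs ▸ ht
    · exact absurd hs.symm (h.ne s t)
  · exact fun hs => .inl ⟨s, hs, rfl⟩

theorem mem_union_right (h : IsProd M₁ M₂ M i j) {I : Finset B₁} {K : Finset B₂} {t : B₂} :
    j t ∈ h.union I K ↔ t ∈ K := by
  rw [union, Finset.mem_union, Finset.mem_image, Finset.mem_image]
  constructor
  · rintro (⟨s, -, hs⟩ | ⟨s, hs, ht⟩)
    · exact absurd hs (h.ne s t)
    · exact h.inj₂ ht ▸ hs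
  · exact fun hs => .inr ⟨t, hs, rfl⟩

theorem exists_union (h : IsProd M₁ M₂ M i j) (I : Finset B) :
    ∃ I₁ I₂, I = h.union I₁ I₂ := by
  refine ⟨Finset.univ.filter fun s => i s ∈ I, Finset.univ.filter fun t => j t ∈ I, ?_⟩
  ext b
  obtain (⟨s, rfl⟩ | ⟨t, rfl⟩) := h.cover b
  · rw [h.mem_union_left, Finset.mem_filter_univ]
  · rw [h.mem_union_right, Finset.mem_filter_univ]

/-- Both sides are products of commuting idempotents in the `e_s`, and each absorbs the other under
multiplication. -/
theorem E_union (h : IsProd M₁ M₂ M i j) (I : Finset B₁) (K : Finset B₂) :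
    Omega.E M (h.union I K) = Omega.parabolic M₁ M i h.matrix₁ (Omega.E M₁ I) *
      Omega.parabolic M₂ M j h.matrix₂ (Omega.E M₂ K) := by
  set p := Omega.parabolic M₁ M i h.matrix₁ with hp
  set q := Omega.parabolic M₂ M j h.matrix₂ with hq
  have hpe : ∀ s, p (Omega.e M₁ s) = Omega.e M (i s) := Omega.parabolic_e _ _ _ _
  have hqe : ∀ s, q (Omega.e M₂ s) = Omega.e M (j s) := Omega.parabolic_e _ _ _ _
  set E := Omega.E M (h.union I K) with hE
  have hpE : p (Omega.E M₁ I) * E = E := Omega.map_E_mul_eq_self M₁ p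
    (fun s hs => by rw [hpe]; exact Omega.e_mul_E_of_mem M (h.mem_union_left.mpr hs))
    (fun s hs => by rw [hpe]; exact Omega.e_mul_E_of_notMem M (h.mem_union_left.not.mpr hs))
  have hqE : q (Omega.E M₂ K) * E = E := Omega.map_E_mul_eq_self M₂ q
    (fun s hs => by rw [hqe]; exact Omega.e_mul_E_of_mem M (h.mem_union_right.mpr hs))
    (fun s hs => by rw [hqe]; exact Omega.e_mul_E_of_notMem M (h.mem_union_right.not.mpr hs))
  have hce : ∀ b, Commute (p (Omega.E M₁ I) * q (Omega.E M₂ K)) (Omega.e M b) := fun b => by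
    have h1 : p (Omega.E M₁ I) ∈ Subalgebra.centralizer ℤ {Omega.e M b} :=
      Omega.E_mem M₁ p _ (fun s => by
        rw [hpe, Subalgebra.mem_centralizer_iff]
        rintro _ rfl
        exact Omega.e_commute M _ _) I
    have h2 : q (Omega.E M₂ K) ∈ Subalgebra.centralizer ℤ {Omega.e M b} :=
      Omega.E_mem M₂ q _ (fun s => by
        rw [hqe, Subalgebra.mem_centralizer_iff]
        rintro _ rfl
        exact Omega.e_commute M _ _) K
    exact ((Subalgebra.mem_centralizer_iff ℤ).mp (mul_mem h1 h2) _ rfl).symm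
  have hl : E * (p (Omega.E M₁ I) * q (Omega.E M₂ K)) = p (Omega.E M₁ I) * q (Omega.E M₂ K) := by
    have hcomm : Commute (p (Omega.E M₁ I)) (q (Omega.E M₂ K)) :=
      h.crossRel.descAlg_commute (k := ℤ)
        (Omega.E_mem M₁ p _ (fun s => by rw [hpe]; exact e_mem_descAlg (e := fun s => _) s) I)
        (Omega.E_mem M₂ q _ (fun s => by rw [hqe]; exact e_mem_descAlg (e := fun s => _) s) K)
    refine Omega.map_E_mul_eq_self M (RingHom.id _) (fun b hb => ?_) fun b hb => ?_ <;>
      rw [RingHom.id_apply] <;> obtain (⟨s, rfl⟩ | ⟨t, rfl⟩) := h.cover b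
    · rw [← mul_assoc, ← hpe, ← map_mul, Omega.e_mul_E_of_mem M₁ (h.mem_union_left.mp hb)]
    · rw [hcomm.eq, ← mul_assoc, ← hqe, ← map_mul,
        Omega.e_mul_E_of_mem M₂ (h.mem_union_right.mp hb)]
    · rw [← mul_assoc, ← hpe, ← map_mul,
        Omega.e_mul_E_of_notMem M₁ (h.mem_union_left.not.mp hb), map_zero, zero_mul]
    · rw [hcomm.eq, ← mul_assoc, ← hqe, ← map_mul,
        Omega.e_mul_E_of_notMem M₂ (h.mem_union_right.not.mp hb), map_zero, zero_mul]
  rw [← hl, ← (Omega.commute_E M hce _).eq, mul_assoc, hqE, hpE]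

theorem parabolic_E_mem_descAlg (h : IsProd M₁ M₂ M i j) (I : Finset B₁) :
    Omega.parabolic M₁ M i h.matrix₁ (Omega.E M₁ I) ∈
      descAlg ℤ (fun s => Omega.e M (i s)) (fun s => Omega.x M (i s)) :=
  Omega.E_mem M₁ _ _ (fun s => by
    rw [Omega.parabolic_e]
    exact e_mem_descAlg (e := fun s => Omega.e M (i s)) s) I

theorem parabolic_X_mem_descAlg (h : IsProd M₁ M₂ M i j) {I J : Finset B₁} (hJ : (J \ I).Nonempty)
    (s : B₁) : Omega.parabolic M₁ M i h.matrix₁ (Omega.X M₁ I J s) ∈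
      descAlg ℤ (fun s => Omega.e M (i s)) (fun s => Omega.x M (i s)) := by
  obtain ⟨w, hw⟩ := hJ
  rw [Omega.X_eq_E_mul_descElt_mul_E M₁ hw, map_mul, map_mul]
  refine mul_mem (mul_mem (h.parabolic_E_mem_descAlg I) ?_) (h.parabolic_E_mem_descAlg J)
  rw [descElt, map_mul, map_mul, map_sub, map_one, Omega.parabolic_e, Omega.parabolic_x]
  exact descElt_mem_descAlg (e := fun s => Omega.e M (i s)) (x := fun s => Omega.x M (i s)) w s

theorem commute_parabolic_E (h : IsProd M₁ M₂ M i j) (I : Finset B₁) (K : Finset B₂) :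
    Commute (Omega.parabolic M₁ M i h.matrix₁ (Omega.E M₁ I))
      (Omega.parabolic M₂ M j h.matrix₂ (Omega.E M₂ K)) :=
  h.crossRel.descAlg_commute (h.parabolic_E_mem_descAlg I) (h.symm.parabolic_E_mem_descAlg K)

theorem X_union (h : IsProd M₁ M₂ M i j) (I J : Finset B₁) (K L : Finset B₂) (s : B₁) :
    Omega.X M (h.union I K) (h.union J L) (i s) =
      Omega.parabolic M₂ M j h.matrix₂ (Omega.E M₂ K) *
        Omega.parabolic M₁ M i h.matrix₁ (Omega.X M₁ I J s) *
        Omega.parabolic M₂ M j h.matrix₂ (Omega.E M₂ L) := by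
  rw [Omega.X, Omega.X, h.E_union, h.E_union, (h.commute_parabolic_E I K).eq, map_mul, map_mul,
    Omega.parabolic_x]
  simp only [mul_assoc]

theorem edge_of_union (h : IsProd M₁ M₂ M i j) {I J : Finset B₁} {K L : Finset B₂} {s : B₁}
    (hs : s ∈ I \ J) (hE : Edge M (h.union I K) (h.union J L)) : Edge M₁ I J := by
  refine ⟨⟨s, hs⟩, fun u hu t ht => ?_⟩
  rw [Finset.mem_sdiff] at hu ht
  rw [← h.matrix₁]
  refine hE.2 _ ?_ _ ?_ <;> rw [Finset.mem_sdiff, h.mem_union_left, h.mem_union_left]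
  exacts [hu, ht]

theorem transversal_union (h : IsProd M₁ M₂ M i j) {I J : Finset B₁} (hIJ : Transversal M₁ I J)
    (K : Finset B₂) : Transversal M (h.union I K) (h.union J K) := by
  have hmem : ∀ I J : Finset B₁, ∀ b ∈ h.union I K \ h.union J K, ∃ s ∈ I \ J, i s = b := by
    intro I J b hb
    rw [Finset.mem_sdiff] at hb
    obtain (⟨s, rfl⟩ | ⟨t, rfl⟩) := h.cover b
    · rw [h.mem_union_left, h.mem_union_left, ← Finset.mem_sdiff] at hb
      exact ⟨s, hb, rfl⟩
    · rw [h.mem_union_right, h.mem_union_right] at hb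
      exact absurd hb.1 hb.2
  have hmem' : ∀ I J : Finset B₁, ∀ s ∈ I \ J, i s ∈ h.union I K \ h.union J K := by
    intro I J s hs
    rw [Finset.mem_sdiff] at hs ⊢
    rwa [h.mem_union_left, h.mem_union_left]
  obtain ⟨⟨⟨s, hs⟩, hE⟩, ⟨t, ht⟩⟩ := hIJ
  refine ⟨⟨⟨i s, hmem' I J s hs⟩, fun u hu v hv => ?_⟩, ⟨i t, hmem' J I t ht⟩⟩
  obtain ⟨u', hu', rfl⟩ := hmem I J u hu
  obtain ⟨v', hv', rfl⟩ := hmem J I v hv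
  rw [h.matrix₁]
  exact hE u' hu' v' hv'

/-- Multiply by `1 = ∑ E_K` from the other factor. A transversal `X_{IJ}` commutes with `E_K`, so it
is the sum of the `X_{I ∪ K, J ∪ K}`, whose edges are again transversal. -/
theorem parabolic_X_mem_Psi (h : IsProd M₁ M₂ M i j) {I J : Finset B₁} (hIJ : Transversal M₁ I J)
    {s : B₁} (hs : s ∈ I \ J) :
    Omega.parabolic M₁ M i h.matrix₁ (Omega.X M₁ I J s) ∈ Psi M := by
  set q := Omega.parabolic M₂ M j h.matrix₂ with hq
  set X := Omega.parabolic M₁ M i h.matrix₁ (Omega.X M₁ I J s) with hX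
  have hsum : X = ∑ K, Omega.X M (h.union I K) (h.union J K) (i s) := by
    calc X = (∑ K, q (Omega.E M₂ K)) * X := by rw [← map_sum, Omega.sum_E, map_one, one_mul]
      _ = _ := by
        rw [Finset.sum_mul]
        refine Finset.sum_congr rfl fun K _ => ?_
        have hc : Commute X (q (Omega.E M₂ K)) := h.crossRel.descAlg_commute
          (h.parabolic_X_mem_descAlg hIJ.2 s) (h.symm.parabolic_E_mem_descAlg K)
        rw [h.X_union, mul_assoc, hc.eq, ← mul_assoc, ← map_mul, Omega.E_idem]
  rw [hsum]
  refine sum_mem fun K _ => Algebra.subset_adjoin (.inr ⟨_, _, h.transversal_union hIJ K, i s, ?_,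
    rfl⟩)
  rw [Finset.mem_sdiff] at hs ⊢
  rwa [h.mem_union_left, h.mem_union_left]

variable {k : Type*} [CommRing k]

theorem kParabolic_mem_KPsi (h : IsProd M₁ M₂ M i j) {a : KOmega k M₁} (ha : a ∈ KPsi k M₁) :
    kParabolic k M₁ M i h.matrix₁ a ∈ KPsi k M := by
  refine map_mem_of_mem_KPsi _ _ (fun s => ?_) (fun I J hIJ s hs => ?_) ha
  · rw [kParabolic_ke]
    exact ke_mem_KPsi (i s)
  · rw [kParabolic_toK]
    exact toK_mem_KPsi (h.parabolic_X_mem_Psi hIJ hs)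

theorem kParabolic_mem_descAlg (h : IsProd M₁ M₂ M i j) {a : KOmega k M₁} (ha : a ∈ KPsi k M₁) :
    kParabolic k M₁ M i h.matrix₁ a ∈
      descAlg k (fun s => ke k M (i s)) (fun s => kx k M (i s)) := by
  have := map_mem_descAlg (kParabolic k M₁ M i h.matrix₁) (KPsi_le_descAlg ha)
  simpa only [kParabolic_ke, kParabolic_kx] using this

theorem kParabolic_commute (h : IsProd M₁ M₂ M i j) {a : KOmega k M₁} {b : KOmega k M₂}
    (ha : a ∈ KPsi k M₁) (hb : b ∈ KPsi k M₂) :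
    Commute (kParabolic k M₁ M i h.matrix₁ a) (kParabolic k M₂ M j h.matrix₂ b) :=
  (h.crossRel_k k).descAlg_commute (h.kParabolic_mem_descAlg ha) (h.symm.kParabolic_mem_descAlg hb)

end Psi

end IsProd

/-! ### The strong decomposition of a product -/

theorem IsCompleteOrth.map {k A A' ι : Type*} [CommRing k] [Ring A] [Algebra k A] [Ring A']
    [Algebra k A'] [Fintype ι] {F : ι → A} (hF : IsCompleteOrth F) (φ : A →ₐ[k] A') :
    IsCompleteOrth fun i => φ (F i) where
  idem i := by rw [← map_mul, hF.idem]
  orth i j hij := by rw [← map_mul, hF.orth i j hij, map_zero]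
  sum_eq_one := by rw [← map_sum, hF.sum_eq_one, map_one]

/-- Since `F F' = 0`, one has `F x F' = -F [F', x] F' = -[e, F g F']`. -/
theorem mul_mul_eq_zero_of_bracket {A : Type*} [Ring A] {F F' e x g : A}
    (h : F' * x - x * F' = e * g - g * e) (ho : F * F' = 0) (hi : F' * F' = F')
    (hc : Commute e F) (hc' : Commute e F') (h0 : F * g * F' = 0) : F * x * F' = 0 := by
  linear_combination (norm := noncomm_ring) -(F * x) * hi - F * h * F' + ho * x * F'
    + hc.eq * g * F' - e * h0 + h0 * e + F * g * hc'.eq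

namespace IsProd

variable {B₁ B₂ B W₁ W₂ W : Type*} {M₁ : CoxeterMatrix B₁} {M₂ : CoxeterMatrix B₂}
  {M : CoxeterMatrix B} {i : B₁ → B} {j : B₂ → B}
  [Fintype B₁] [DecidableEq B₁] [Fintype B₂] [DecidableEq B₂] [Fintype B] [DecidableEq B]
  [Group W₁] [Finite W₁] [Group W₂] [Finite W₂] [Group W] [Finite W]
  {cs₁ : CoxeterSystem M₁ W₁} {cs₂ : CoxeterSystem M₂ W₂}
  {k : Type*} [CommRing k] {F₁ : Irr W₁ → KOmega k M₁} {le₁ : Irr W₁ → Irr W₁ → Prop}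
  {F₂ : Irr W₂ → KOmega k M₂} {le₂ : Irr W₂ → Irr W₂ → Prop}

theorem le_of_ne_zero (h : IsProd M₁ M₂ M i j) (D₂ : IsStrongDecomposition k cs₂ F₂ le₂)
    (μ ν : Irr W₂) (a : KOmega k M)
    (ha : kParabolic k M₂ M j h.matrix₂ (F₂ μ) * a * kParabolic k M₂ M j h.matrix₂ (F₂ ν) ≠ 0) :
    le₂ μ ν := by
  set φ := kParabolic k M₂ M j h.matrix₂ with hφ
  have hF := D₂.isCompleteOrth.map φ
  have himage : ∀ (b : KOmega k M₂) (μ ν : Irr W₂), φ (F₂ μ) * φ b * φ (F₂ ν) ≠ 0 → le₂ μ ν :=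
    fun b μ ν hb => by
      rw [← map_mul, ← map_mul] at hb
      exact D₂.le_of_ne_zero μ ν ⟨b, fun h0 => hb (by rw [h0, map_zero])⟩
  suffices hle : genAlg k (ke k M) (kx k M) ≤ blockTriangular k hF D₂.le_refl D₂.le_trans from
    hle (genAlg_eq_top (k := k) (M := M) ▸ trivial) μ ν ha
  have hmem : ∀ χ, φ (F₂ χ) ∈ descAlg k (fun s => ke k M (j s)) (fun s => kx k M (j s)) :=
    fun χ => h.symm.kParabolic_mem_descAlg (D₂.mem_psi χ)
  have he : ∀ s χ, Commute (ke k M (i s)) (φ (F₂ χ)) := fun s χ =>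
    (h.crossRel_k k).e_commute_of_mem_descAlg s (hmem χ)
  refine Algebra.adjoin_le ?_
  rintro _ (⟨b, rfl⟩ | ⟨b, rfl⟩) μ ν hb <;> obtain (⟨s, rfl⟩ | ⟨t, rfl⟩) := h.cover b <;>
    beta_reduce at hb
  · by_cases hμν : μ = ν
    · exact hμν ▸ D₂.le_refl μ
    · rw [← (he s μ).eq, mul_assoc, hF.orth μ ν hμν, mul_zero] at hb
      exact absurd rfl hb
  · rw [← kParabolic_ke M₂ M j h.matrix₂] at hb
    exact himage _ μ ν hb
  · by_cases hμν : μ = ν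
    · exact hμν ▸ D₂.le_refl μ
    -- The only generators not covered by commutation or by (Z3) of the factor are the `x_s` of the
    -- other factor; the bracket reduces them to an element `g` in the image of `φ`.
    obtain ⟨g, hg, hbr⟩ := (h.crossRel_k k).exists_bracket s (hmem ν)
    have hg' : g ∈ (genAlg k (ke k M₂) (kx k M₂)).map φ := by
      rw [genAlg_map]
      simpa only [hφ, kParabolic_ke, kParabolic_kx] using hg
    obtain ⟨g', -, hgg⟩ := hg'
    change φ g' = g at hgg
    subst hgg
    by_contra hle
    refine hb ?_
    have h0 : φ (F₂ μ) * φ g' * φ (F₂ ν) = 0 := by_contra fun h0 => hle (himage g' μ ν h0)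
    exact mul_mul_eq_zero_of_bracket hbr (hF.orth μ ν hμν) (hF.idem ν) (he s μ) (he s ν) h0
  · rw [← kParabolic_kx M₂ M j h.matrix₂] at hb
    exact himage _ μ ν hb

/-- Only `F₁` has to move: it commutes with `F₂`, `E_K` and `E_L`, and closes up around the edge
element of the first factor, where (Z5) applies. -/
theorem kParabolic_edge_mem (h : IsProd M₁ M₂ M i j) (D₁ : IsStrongDecomposition k cs₁ F₁ le₁)
    (D₂ : IsStrongDecomposition k cs₂ F₂ le₂) (χ : Irr W₁) (μ : Irr W₂) {I J : Finset B}
    (hIJ : Edge M I J) (s : B₁) (hs : i s ∈ I \ J) :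
    kParabolic k M₁ M i h.matrix₁ (F₁ χ) * kParabolic k M₂ M j h.matrix₂ (F₂ μ) *
      toK k (Omega.X M I J (i s)) *
      (kParabolic k M₁ M i h.matrix₁ (F₁ χ) * kParabolic k M₂ M j h.matrix₂ (F₂ μ)) ∈ KPsi k M := by
  obtain ⟨I, K, rfl⟩ := h.exists_union I
  obtain ⟨J, L, rfl⟩ := h.exists_union J
  rw [Finset.mem_sdiff, h.mem_union_left, h.mem_union_left, ← Finset.mem_sdiff] at hs
  have hE : ∀ K, toK k (Omega.E M₂ K) ∈ KPsi k M₂ := fun K =>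
    toK_mem_KPsi (Algebra.subset_adjoin (.inl ⟨K, rfl⟩))
  have hμ := D₂.mem_psi μ
  have hX := D₁.edge_mem χ I J (h.edge_of_union hs hIJ) s hs
  rw [h.X_union, ← toKHom_apply, map_mul, map_mul, toKHom_apply, toKHom_apply, toKHom_apply,
    ← kParabolic_toK, ← kParabolic_toK, ← kParabolic_toK]
  set φ := kParabolic k M₁ M i h.matrix₁
  set ψ := kParabolic k M₂ M j h.matrix₂
  have hc : ∀ b ∈ KPsi k M₂, φ (F₁ χ) * ψ b = ψ b * φ (F₁ χ) := fun b hb =>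
    (h.kParabolic_commute (D₁.mem_psi χ) hb).eq
  have : φ (F₁ χ) * ψ (F₂ μ) * (ψ (toK k (Omega.E M₂ K)) * φ (toK k (Omega.X M₁ I J s)) *
      ψ (toK k (Omega.E M₂ L))) * (φ (F₁ χ) * ψ (F₂ μ)) =
      ψ (F₂ μ * toK k (Omega.E M₂ K)) * φ (F₁ χ * toK k (Omega.X M₁ I J s) * F₁ χ) *
        ψ (toK k (Omega.E M₂ L) * F₂ μ) := by
    have h1 := hc _ (mul_mem hμ (hE K))
    have h2 := hc _ (hE L)
    simp only [map_mul] at h1 ⊢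
    linear_combination (norm := noncomm_ring) h1 * (φ (toK k (Omega.X M₁ I J s)) *
      ψ (toK k (Omega.E M₂ L)) * φ (F₁ χ) * ψ (F₂ μ))
      - (ψ (F₂ μ) * ψ (toK k (Omega.E M₂ K)) * φ (F₁ χ) * φ (toK k (Omega.X M₁ I J s))) * h2 *
        ψ (F₂ μ)
  rw [this]
  exact mul_mem (mul_mem (h.symm.kParabolic_mem_KPsi (mul_mem hμ (hE K)))
    (h.kParabolic_mem_KPsi hX)) (h.symm.kParabolic_mem_KPsi (mul_mem (hE L) hμ))

theorem isStrongDecomposition (h : IsProd M₁ M₂ M i j) (cs : CoxeterSystem M W)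
    (box : Irr W₁ × Irr W₂ ≃ Irr W)
    (hdeg : ∀ χ μ, (box (χ, μ)).degree = χ.degree * μ.degree)
    (D₁ : IsStrongDecomposition k cs₁ F₁ le₁) (D₂ : IsStrongDecomposition k cs₂ F₂ le₂) :
    IsStrongDecomposition k cs
      (fun χ => kParabolic k M₁ M i h.matrix₁ (F₁ (box.symm χ).1) *
        kParabolic k M₂ M j h.matrix₂ (F₂ (box.symm χ).2))
      (fun χ ψ => le₁ (box.symm χ).1 (box.symm ψ).1 ∧ le₂ (box.symm χ).2 (box.symm ψ).2) := by
  have hE₁ := fun χ μ (I J : Finset B) => h.kParabolic_edge_mem D₁ D₂ χ μ (I := I) (J := J)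
  have hE₂ := fun μ χ (I J : Finset B) => h.symm.kParabolic_edge_mem D₂ D₁ μ χ (I := I) (J := J)
  have hle₁ := fun χ χ' a => h.symm.le_of_ne_zero D₁ χ χ' a
  have hle₂ := fun μ μ' a => h.le_of_ne_zero D₂ μ μ' a
  have hF₁ := D₁.isCompleteOrth.map (kParabolic k M₁ M i h.matrix₁)
  have hF₂ := D₂.isCompleteOrth.map (kParabolic k M₂ M j h.matrix₂)
  have hcomm : ∀ a ∈ KPsi k M₁, ∀ b ∈ KPsi k M₂, kParabolic k M₁ M i h.matrix₁ a *
      kParabolic k M₂ M j h.matrix₂ b = kParabolic k M₂ M j h.matrix₂ b *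
      kParabolic k M₁ M i h.matrix₁ a := fun a ha b hb => (h.kParabolic_commute ha hb).eq
  have hm₁ : ∀ a ∈ KPsi k M₁, kParabolic k M₁ M i h.matrix₁ a ∈ KPsi k M := fun a =>
    h.kParabolic_mem_KPsi
  have hm₂ : ∀ a ∈ KPsi k M₂, kParabolic k M₂ M j h.matrix₂ a ∈ KPsi k M := fun a =>
    h.symm.kParabolic_mem_KPsi
  have hE₁' : ∀ I, toK k (Omega.E M₁ I) ∈ KPsi k M₁ := fun I =>
    toK_mem_KPsi (Algebra.subset_adjoin (.inl ⟨I, rfl⟩))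
  have hE₂' : ∀ K, toK k (Omega.E M₂ K) ∈ KPsi k M₂ := fun K =>
    toK_mem_KPsi (Algebra.subset_adjoin (.inl ⟨K, rfl⟩))
  have hEu : ∀ I K, toK k (Omega.E M (h.union I K)) =
      kParabolic k M₁ M i h.matrix₁ (toK k (Omega.E M₁ I)) *
        kParabolic k M₂ M j h.matrix₂ (toK k (Omega.E M₂ K)) := fun I K => by
    rw [h.E_union, ← toKHom_apply, map_mul, kParabolic_toK, kParabolic_toK]
    rfl
  have hφe := kParabolic_ke (k := k) M₁ M i h.matrix₁
  have hφx := kParabolic_kx (k := k) M₁ M i h.matrix₁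
  have hψe := kParabolic_ke (k := k) M₂ M j h.matrix₂
  have hψx := kParabolic_kx (k := k) M₂ M j h.matrix₂
  set φ := kParabolic k M₁ M i h.matrix₁
  set ψ := kParabolic k M₂ M j h.matrix₂
  have hFF : ∀ χ μ, φ (F₁ χ) * ψ (F₂ μ) = ψ (F₂ μ) * φ (F₁ χ) := fun χ μ =>
    hcomm _ (D₁.mem_psi χ) _ (D₂.mem_psi μ)
  have hmul : ∀ χ μ χ' μ', φ (F₁ χ) * ψ (F₂ μ) * (φ (F₁ χ') * ψ (F₂ μ')) =
      φ (F₁ χ) * φ (F₁ χ') * (ψ (F₂ μ) * ψ (F₂ μ')) := fun χ μ χ' μ' => by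
    linear_combination (norm := noncomm_ring) -(φ (F₁ χ) * hFF χ' μ * ψ (F₂ μ'))
  have hle : ∀ χ μ χ' μ' a, φ (F₁ χ) * ψ (F₂ μ) * a * (φ (F₁ χ') * ψ (F₂ μ')) ≠ 0 →
      le₁ χ χ' ∧ le₂ μ μ' := fun χ μ χ' μ' a ha => by
    constructor
    · refine hle₁ χ χ' a fun h0 => ha ?_
      linear_combination (norm := noncomm_ring) hFF χ μ * a * φ (F₁ χ') * ψ (F₂ μ') +
        ψ (F₂ μ) * h0 * ψ (F₂ μ')
    · refine hle₂ μ μ' a fun h0 => ha ?_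
      linear_combination (norm := noncomm_ring) φ (F₁ χ) * ψ (F₂ μ) * a * hFF χ' μ' +
        φ (F₁ χ) * h0 * φ (F₁ χ')
  have hanti : ∀ χ ψ, (le₁ (box.symm χ).1 (box.symm ψ).1 ∧ le₂ (box.symm χ).2 (box.symm ψ).2) →
      (le₁ (box.symm ψ).1 (box.symm χ).1 ∧ le₂ (box.symm ψ).2 (box.symm χ).2) → χ = ψ :=
    fun χ ψ h1 h2 => box.symm.injective (Prod.ext (D₁.le_antisymm _ _ h1.1 h2.1)
      (D₂.le_antisymm _ _ h1.2 h2.2))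
  have hF : IsCompleteOrth fun χ => φ (F₁ (box.symm χ).1) * ψ (F₂ (box.symm χ).2) := by
    refine ⟨fun χ => ?_, fun χ χ' hχ => ?_, ?_⟩
    · simp only [hmul, hF₁.idem, hF₂.idem]
    · simp only [hmul]
      by_cases h1 : (box.symm χ).1 = (box.symm χ').1
      · have h2 : (box.symm χ).2 ≠ (box.symm χ').2 := fun h2 =>
          hχ (box.symm.injective (Prod.ext h1 h2))
        rw [hF₂.orth _ _ h2, mul_zero]
      · rw [hF₁.orth _ _ h1, zero_mul]
    · rw [Equiv.sum_comp box.symm (fun p => φ (F₁ p.1) * ψ (F₂ p.2)), Fintype.sum_prod_type]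
      simp only [← Finset.mul_sum, hF₂.sum_eq_one, mul_one, hF₁.sum_eq_one]
  have hpsi : ∀ χ μ, φ (F₁ χ) * ψ (F₂ μ) ∈ KPsi k M := fun χ μ =>
    mul_mem (hm₁ _ (D₁.mem_psi χ)) (hm₂ _ (D₂.mem_psi μ))
  exact
  { idem := hF.idem
    orth := hF.orth
    sum_eq_one := hF.sum_eq_one
    comm := fun χ I => by
      obtain ⟨I, K, rfl⟩ := h.exists_union I
      rw [hEu]
      have hI := hE₁' I
      have hK := hE₂' K
      have h1 : Commute (φ (toK k (Omega.E M₁ I))) (φ (F₁ (box.symm χ).1)) :=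
        Commute.map (D₁.comm _ I) φ
      have h2 : Commute (ψ (toK k (Omega.E M₂ K))) (ψ (F₂ (box.symm χ).2)) :=
        Commute.map (D₂.comm _ K) ψ
      have h3 := hcomm _ hI _ (D₂.mem_psi (box.symm χ).2)
      have h4 := (hcomm _ (D₁.mem_psi (box.symm χ).1) _ hK).symm
      exact (h1.mul_right h3).mul_left (Commute.mul_right h4 h2)
    le_refl := fun χ => ⟨D₁.le_refl _, D₂.le_refl _⟩
    le_trans := fun χ ψ θ h1 h2 => ⟨D₁.le_trans _ _ _ h1.1 h2.1, D₂.le_trans _ _ _ h1.2 h2.2⟩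
    le_antisymm := hanti
    le_of_ne_zero := fun χ χ' ⟨a, ha⟩ => hle _ _ _ _ a ha
    exists_surj := fun χ => by
      obtain ⟨⟨χ, μ⟩, rfl⟩ := box.surjective χ
      obtain ⟨θ₁, h1, r1⟩ := D₁.exists_surj χ
      obtain ⟨θ₂, h2, r2⟩ := D₂.exists_surj μ
      have hθ₁ : ∀ a, θ₁ a ∈ KPsi k M₁ := fun a => by
        obtain ⟨b, hb⟩ := r1 ▸ Set.mem_range_self a
        exact hb ▸ D₁.corner_mem_KPsi χ b
      have hθ₂ : ∀ a, θ₂ a ∈ KPsi k M₂ := fun a => by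
        obtain ⟨b, hb⟩ := r2 ▸ Set.mem_range_self a
        exact hb ▸ D₂.corner_mem_KPsi μ b
      obtain ⟨θ, hθ, hr⟩ := exists_kronecker_hom
        (finProdFinEquiv.trans (finCongr (hdeg χ μ).symm))
        ((φ : KOmega k M₁ →ₙₐ[k] KOmega k M).comp θ₁)
        ((ψ : KOmega k M₂ →ₙₐ[k] KOmega k M).comp θ₂) fun a b => hcomm _ (hθ₁ a) _ (hθ₂ b)
      have hr' : ∀ a b, φ (F₁ χ * a * F₁ χ) * ψ (F₂ μ * b * F₂ μ) ∈ Set.range θ := fun a b => by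
        obtain ⟨a', ha'⟩ : F₁ χ * a * F₁ χ ∈ Set.range θ₁ := by rw [r1]; exact ⟨a, rfl⟩
        obtain ⟨b', hb'⟩ : F₂ μ * b * F₂ μ ∈ Set.range θ₂ := by rw [r2]; exact ⟨b, rfl⟩
        rw [← ha', ← hb']
        exact hr a' b'
      have hθ1 : θ 1 = φ (F₁ χ) * ψ (F₂ μ) := by
        rw [hθ, ← h1, ← h2]
        rfl
      refine ⟨θ, by rw [hθ1, box.symm_apply_apply], Set.ext fun b => ⟨?_, ?_⟩⟩
      · rintro ⟨a, rfl⟩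
        refine ⟨θ a, ?_⟩
        -- The image of `θ` lies in the corner because `θ a = θ (1 * a * 1)`.
        rw [box.symm_apply_apply, ← hθ1, ← map_mul, ← map_mul, one_mul, mul_one]
      · rintro ⟨a, rfl⟩
        refine hF.corner_mem (k := k) hanti (fun χ χ' a ha => hle _ _ _ _ a ha) (box (χ, μ))
          (NonUnitalAlgHom.range θ) ?_ (s := Set.range (ke k M) ∪ Set.range (kx k M)) ?_
          (show a ∈ genAlg k (ke k M) (kx k M) by rw [genAlg_eq_top]; trivial)
        all_goals simp only [box.symm_apply_apply]
        · exact ⟨1, hθ1⟩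
        have hi₁ : φ (F₁ χ) * φ (F₁ χ) = φ (F₁ χ) := hF₁.idem χ
        have hi₂ : ψ (F₂ μ) * ψ (F₂ μ) = ψ (F₂ μ) := hF₂.idem μ
        -- For `a` from the first factor the corner element is `φ (F₁ a F₁) ψ (F₂)`. It is `F₁ a
        -- F₁`, and not `a` itself, that lies in `kΨ₁` and commutes with `ψ (F₂)`.
        have hl : ∀ a, φ (F₁ χ) * ψ (F₂ μ) * φ a * (φ (F₁ χ) * ψ (F₂ μ)) ∈ Set.range θ :=
          fun a => by
            have e1 := (hcomm _ (D₁.corner_mem_KPsi χ a) _ (D₂.mem_psi μ)).symm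
            have e2 := hr' a 1
            rw [mul_one, D₂.idem] at e2
            convert e2 using 1
            simp only [map_mul] at e1 ⊢
            linear_combination (norm := noncomm_ring)
              hFF χ μ * φ a * φ (F₁ χ) * ψ (F₂ μ) + e1 * ψ (F₂ μ) +
                φ (F₁ χ) * φ a * φ (F₁ χ) * hi₂
        have hr : ∀ a, φ (F₁ χ) * ψ (F₂ μ) * ψ a * (φ (F₁ χ) * ψ (F₂ μ)) ∈ Set.range θ :=
          fun a => by
            have e1 := hcomm _ (D₁.mem_psi χ) _ (D₂.corner_mem_KPsi μ a)
            have e2 := hr' 1 a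
            rw [mul_one, D₁.idem] at e2
            convert e2 using 1
            simp only [map_mul] at e1 ⊢
            linear_combination (norm := noncomm_ring)
              φ (F₁ χ) * ψ (F₂ μ) * ψ a * hFF χ μ - φ (F₁ χ) * e1
                + hi₁ * ψ (F₂ μ) * ψ a * ψ (F₂ μ)
        rintro _ (⟨b, rfl⟩ | ⟨b, rfl⟩) <;> obtain (⟨s, rfl⟩ | ⟨t, rfl⟩) := h.cover b
        · rw [← hφe]; exact hl _
        · rw [← hψe]; exact hr _
        · rw [← hφx]; exact hl _
        · rw [← hψx]; exact hr _
    edge_mem := fun χ I J hIJ b hb => by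
      obtain (⟨s, rfl⟩ | ⟨t, rfl⟩) := h.cover b
      · exact hE₁ _ _ I J hIJ s hb
      · have := hE₂ (box.symm χ).2 (box.symm χ).1 I J hIJ t hb
        rwa [hFF]
    mem_psi := fun χ => hpsi _ _ }

end IsProd

end WGraph

/-! ### Irreducible characters of a product -/

namespace Representation

/-! ### Irreducibility from the norm of the character -/

section Norm

variable {G V : Type*} [Group G] [Fintype G] [AddCommGroup V] [Module ℂ V] [FiniteDimensional ℂ V]

/-- By Maschke an invariant subspace has an invariant complement; the projection is a scalar, so one
of the two is zero. -/
theorem isIrreducible_of_finrank_eq_one {ρ : Representation ℂ G V}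
    (h : Module.finrank ℂ (IntertwiningMap ρ ρ) = 1) : ρ.IsIrreducible := by
  have hne : NeZero (Nat.card G : ℂ) := ⟨by exact_mod_cast Nat.card_pos.ne'⟩
  have h1 : Module.finrank ℂ (Module.End (MonoidAlgebra ℂ G) ρ.asModule) = 1 :=
    (LinearEquiv.finrank_eq (IntertwiningMap.equivLinearMapAsModule ρ ρ)).symm.trans h
  rw [irreducible_iff_isSimpleModule_asModule, isSimpleModule_iff]
  have hnt : Nontrivial (Module.End (MonoidAlgebra ℂ G) ρ.asModule) :=
    Module.nontrivial_of_finrank_pos (R := ℂ) (by omega)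
  have hntm : Nontrivial ρ.asModule := by
    by_contra hs
    rw [not_nontrivial_iff_subsingleton] at hs
    exact not_subsingleton (Module.End (MonoidAlgebra ℂ G) ρ.asModule) inferInstance
  refine { toNontrivial := inferInstance, eq_bot_or_eq_top := fun p => ?_ }
  obtain ⟨q, hpq⟩ := exists_isCompl p
  obtain ⟨c, hc⟩ := (finrank_eq_one_iff_of_nonzero' (1 : Module.End (MonoidAlgebra ℂ G) ρ.asModule)
    one_ne_zero).mp h1 (p.subtype.comp (p.projectionOnto q hpq))
  have hP : ∀ v, c • v = (p.projectionOnto q hpq v : ρ.asModule) :=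
    fun v => LinearMap.congr_fun hc v
  by_cases hc0 : c = 0
  · left
    rw [eq_bot_iff]
    intro v hv
    have h2 := hP v
    rw [hc0, zero_smul, Submodule.projectionOnto_apply_left hpq ⟨v, hv⟩] at h2
    exact h2.symm
  · right
    have hq : q = ⊥ := by
      rw [eq_bot_iff]
      intro v hv
      have h2 := hP v
      rw [Submodule.projectionOnto_apply_right hpq ⟨v, hv⟩, Submodule.coe_zero] at h2
      exact (smul_eq_zero.mp h2).resolve_left hc0
    rw [← sup_bot_eq p, ← hq, hpq.sup_eq_top]

theorem sum_char_mul_char_inv {ρ : Representation ℂ G V} (h : ρ.IsIrreducible) :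
    ∑ g, ρ.character g * ρ.character g⁻¹ = Nat.card G := by
  have hG : (Nat.card G : ℂ) ≠ 0 := by exact_mod_cast Nat.card_pos.ne'
  let _ : Invertible (Nat.card G : ℂ) := invertibleOfNonzero hG
  have h1 := char_orthonormal ρ ρ
  rw [if_pos ⟨Equiv.refl ρ⟩] at h1
  rwa [inv_mul_eq_one₀ hG, eq_comm] at h1

theorem isIrreducible_of_char_norm {ρ : Representation ℂ G V}
    (h : ∑ g, ρ.character g * ρ.character g⁻¹ = Nat.card G) : ρ.IsIrreducible := by
  have hG : (Nat.card G : ℂ) ≠ 0 := by exact_mod_cast Nat.card_pos.ne'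
  let _ : Invertible (Nat.card G : ℂ) := invertibleOfNonzero hG
  have h1 := card_inv_mul_sum_char_mul_char_eq_finrank ρ ρ
  rw [h, inv_mul_cancel₀ hG] at h1
  exact isIrreducible_of_finrank_eq_one (by exact_mod_cast h1.symm)

end Norm

/-- The representation on `Fin d → ℂ` in coordinates. -/
theorem exists_equiv_fin {G V : Type*} [Group G] [AddCommGroup V] [Module ℂ V]
    [FiniteDimensional ℂ V] (ρ : Representation ℂ G V) :
    ∃ τ : Representation ℂ G (Fin (Module.finrank ℂ V) → ℂ), Nonempty (Equiv τ ρ) := by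
  let e := (Module.finBasis ℂ V).equivFun
  refine ⟨(e.conjAlgEquiv ℂ : Module.End ℂ V →* Module.End ℂ _).comp ρ,
    ⟨Equiv.mk e.symm fun g => LinearMap.ext fun v => ?_⟩⟩
  simp

theorem IsIrreducible.of_equiv {G V V' : Type*} [Group G] [Finite G] [AddCommGroup V] [Module ℂ V]
    [FiniteDimensional ℂ V] [AddCommGroup V'] [Module ℂ V'] [FiniteDimensional ℂ V']
    {ρ : Representation ℂ G V} {τ : Representation ℂ G V'} (φ : Equiv τ ρ) (h : ρ.IsIrreducible) :
    τ.IsIrreducible := by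
  have := Fintype.ofFinite G
  refine isIrreducible_of_char_norm ?_
  rw [char_iso φ]
  exact sum_char_mul_char_inv h

/-- A nonzero representation of a finite group contains an irreducible one. -/
theorem exists_irreducible_hom {G V : Type*} [Group G] [Finite G] [AddCommGroup V] [Module ℂ V]
    [FiniteDimensional ℂ V] [Nontrivial V] (ρ : Representation ℂ G V) :
    ∃ (d : ℕ) (τ : Representation ℂ G (Fin d → ℂ)), τ.IsIrreducible ∧
      ∃ f : IntertwiningMap τ ρ, f ≠ 0 := by
  induction hn : Module.finrank ℂ V using Nat.strong_induction_on generalizing V with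
  | _ n ih =>
  by_cases hρ : ρ.IsIrreducible
  · obtain ⟨τ, ⟨φ⟩⟩ := ρ.exists_equiv_fin
    refine ⟨_, τ, .of_equiv φ hρ, φ.toIntertwiningMap, fun h0 => ?_⟩
    obtain ⟨v, hv⟩ := exists_ne (0 : V)
    apply hv
    rw [← φ.apply_symm_apply v]
    exact DFunLike.congr_fun h0 _
  · have hnt : Nontrivial (Subrepresentation ρ) := by
      refine ⟨⊥, ⊤, fun h => ?_⟩
      obtain ⟨v, hv⟩ := exists_ne (0 : V)
      have : v ∈ (⊥ : Subrepresentation ρ) := by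
        rw [h]
        exact Submodule.mem_top (R := ℂ)
      exact hv this
    obtain ⟨p, hp⟩ : ∃ p : Subrepresentation ρ, ¬ (p = ⊥ ∨ p = ⊤) := by
      by_contra! hc
      exact hρ { eq_bot_or_eq_top := hc }
    rw [not_or] at hp
    have hbot : p.toSubmodule ≠ ⊥ := fun h => hp.1 (Subrepresentation.toSubmodule_injective h)
    have htop : p.toSubmodule ≠ ⊤ := fun h => hp.2 (Subrepresentation.toSubmodule_injective h)
    have : Nontrivial p.toSubmodule := (Submodule.nontrivial_iff_ne_bot).mpr hbot
    obtain ⟨d, τ, hτ, f, hf⟩ := ih _ (hn ▸ Submodule.finrank_lt htop) p.toRepresentation rfl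
    refine ⟨d, τ, hτ, ⟨p.toSubmodule.subtype ∘ₗ f.toLinearMap, fun g => ?_⟩, fun h0 => hf ?_⟩
    · refine LinearMap.ext fun v => ?_
      exact congrArg Subtype.val (f.isIntertwining _ _ g v)
    · refine IntertwiningMap.ext (LinearMap.ext fun v => Subtype.ext ?_)
      exact DFunLike.congr_fun h0 v

/-! ### Outer tensor products -/

section Outer

variable {G H V V' : Type*} [Group G] [Group H] [AddCommGroup V] [Module ℂ V]
  [FiniteDimensional ℂ V] [AddCommGroup V'] [Module ℂ V'] [FiniteDimensional ℂ V']

/-- The outer tensor product of representations. -/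
noncomputable def outer (ρ : Representation ℂ G V) (σ : Representation ℂ H V') :
    Representation ℂ (G × H) (V ⊗[ℂ] V') :=
  Representation.tprod (ρ.comp (MonoidHom.fst G H)) (σ.comp (MonoidHom.snd G H))

theorem outer_character (ρ : Representation ℂ G V) (σ : Representation ℂ H V') (g : G × H) :
    (ρ.outer σ).character g = ρ.character g.1 * σ.character g.2 := by
  rw [outer, char_tensor]
  rfl

theorem IsIrreducible.outer [Finite G] [Finite H] {ρ : Representation ℂ G V}
    {σ : Representation ℂ H V'} (hρ : ρ.IsIrreducible) (hσ : σ.IsIrreducible) :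
    (ρ.outer σ).IsIrreducible := by
  have := Fintype.ofFinite G
  have := Fintype.ofFinite H
  refine isIrreducible_of_char_norm ?_
  rw [Nat.card_prod, Nat.cast_mul, ← sum_char_mul_char_inv hρ, ← sum_char_mul_char_inv hσ,
    Fintype.sum_prod_type, Finset.sum_mul_sum]
  refine Finset.sum_congr rfl fun g _ => Finset.sum_congr rfl fun h _ => ?_
  rw [outer_character, outer_character]
  exact mul_mul_mul_comm _ _ _ _

/-- The action of `H` on the `G`-equivariant maps into a representation of `G × H`. -/
noncomputable def homRep (τ : Representation ℂ G V') (ρ : Representation ℂ (G × H) V) :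
    Representation ℂ H (IntertwiningMap τ (ρ.comp (MonoidHom.inl G H))) where
  toFun h :=
    { toFun := fun f => ⟨ρ (1, h) ∘ₗ f.toLinearMap, fun g => LinearMap.ext fun v => by
        have h1 : f (τ g v) = ρ (g, 1) (f v) := f.isIntertwining _ _ g v
        change ρ (1, h) (f (τ g v)) = ρ (g, 1) (ρ (1, h) (f v))
        rw [h1, ← Module.End.mul_apply, ← Module.End.mul_apply, ← map_mul, ← map_mul,
          Prod.mk_mul_mk, Prod.mk_mul_mk, one_mul, one_mul, mul_one, mul_one]⟩
      map_add' := fun f f' => by ext; simp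
      map_smul' := fun c f => by ext; simp }
  map_one' := by
    ext f v
    change ρ 1 (f v) = f v
    rw [map_one, Module.End.one_apply]
  map_mul' a b := by
    ext f v
    change ρ (1, a * b) (f v) = ρ (1, a) (ρ (1, b) (f v))
    rw [← Module.End.mul_apply, ← map_mul, Prod.mk_mul_mk, one_mul]

theorem homRep_apply (τ : Representation ℂ G V') (ρ : Representation ℂ (G × H) V) (h : H)
    (f : IntertwiningMap τ (ρ.comp (MonoidHom.inl G H))) (v : V') :
    (homRep τ ρ h f) v = ρ (1, h) (f v) := rfl

/-- Take an irreducible `τ` mapping nontrivially to `ρ` restricted to `G`, then an irreducible `σ`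
mapping nontrivially to the `H`-representation `Hom_G(τ, ρ)`. Evaluation is a nonzero map between
irreducibles, hence bijective by Schur. -/
theorem exists_outer_equiv [Finite G] [Finite H] {ρ : Representation ℂ (G × H) V}
    (hρ : ρ.IsIrreducible) :
    ∃ (d : ℕ) (τ : Representation ℂ G (Fin d → ℂ)) (d' : ℕ)
      (σ : Representation ℂ H (Fin d' → ℂ)), τ.IsIrreducible ∧ σ.IsIrreducible ∧
        Nonempty (Equiv (τ.outer σ) ρ) := by
  have hnt : Nontrivial V := by
    by_contra hs
    rw [not_nontrivial_iff_subsingleton] at hs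
    exact (bot_ne_top (α := Subrepresentation ρ)) (Subrepresentation.toSubmodule_injective
      (Subsingleton.elim _ _))
  obtain ⟨d, τ, hτ, f, hf⟩ := exists_irreducible_hom (ρ.comp (MonoidHom.inl G H))
  have : Nontrivial (IntertwiningMap τ (ρ.comp (MonoidHom.inl G H))) := ⟨f, 0, hf⟩
  obtain ⟨d', σ, hσ, f', hf'⟩ := exists_irreducible_hom (homRep τ ρ)
  refine ⟨d, τ, d', σ, hτ, hσ, ?_⟩
  let T : (Fin d → ℂ) ⊗[ℂ] (Fin d' → ℂ) →ₗ[ℂ] V :=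
    TensorProduct.lift ((IntertwiningMap.toLinearMapl τ _ ∘ₗ f'.toLinearMap).flip)
  have hT : ∀ u w, T (u ⊗ₜ w) = f' w u := fun u w => rfl
  let F : IntertwiningMap (τ.outer σ) ρ := ⟨T, fun g => TensorProduct.ext' fun u w => by
    have h1 : f' (σ g.2 w) = homRep τ ρ g.2 (f' w) := f'.isIntertwining _ _ g.2 w
    have h2 : f' w (τ g.1 u) = ρ (g.1, 1) (f' w u) := (f' w).isIntertwining _ _ g.1 u
    change T (τ g.1 u ⊗ₜ σ g.2 w) = ρ g (T (u ⊗ₜ w))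
    rw [hT, hT, h1, homRep_apply, h2, ← Module.End.mul_apply, ← map_mul, Prod.mk_mul_mk, one_mul,
      mul_one]⟩
  have := hτ.outer hσ
  rcases IsIrreducible.bijective_or_eq_zero F with hF | hF
  · exact ⟨F.ofBijective hF⟩
  · exfalso
    refine hf' (IntertwiningMap.ext (LinearMap.ext fun w => IntertwiningMap.ext
      (LinearMap.ext fun u => ?_)))
    exact DFunLike.congr_fun hF (u ⊗ₜ w)

end Outer

end Representation

namespace WGraph

/-! ### The bijection between pairs of characters and characters of the product -/

namespace Irr

variable {W W₁ W₂ : Type*} [Group W] [Group W₁] [Group W₂] [Finite W₁] [Finite W₂]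

theorem exists_of_isIrreducible [Finite W] {V : Type*} [AddCommGroup V] [Module ℂ V]
    [FiniteDimensional ℂ V] {ρ : Representation ℂ W V} (h : ρ.IsIrreducible) :
    ∃ χ : Irr W, (χ : W → ℂ) = ρ.character := by
  obtain ⟨τ, ⟨φ⟩⟩ := ρ.exists_equiv_fin
  exact ⟨⟨τ.character, _, τ, .of_equiv φ h, rfl⟩, Representation.char_iso φ⟩

theorem exists_boxProd (χ : Irr W₁) (μ : Irr W₂) :
    ∃ θ : Irr (W₁ × W₂), ∀ w, θ w = χ w.1 * μ w.2 := by
  obtain ⟨ρ, hρ, h⟩ := χ.exists_rep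
  obtain ⟨σ, hσ, h'⟩ := μ.exists_rep
  obtain ⟨θ, hθ⟩ := exists_of_isIrreducible (hρ.outer hσ)
  refine ⟨θ, fun w => ?_⟩
  rw [hθ, Representation.outer_character, h, h']

/-- The character `χ ⊠ μ` of the product. -/
noncomputable def boxProd (p : Irr W₁ × Irr W₂) : Irr (W₁ × W₂) := (exists_boxProd p.1 p.2).choose

theorem boxProd_apply (p : Irr W₁ × Irr W₂) (w : W₁ × W₂) :
    boxProd p w = p.1 w.1 * p.2 w.2 := (exists_boxProd p.1 p.2).choose_spec w

theorem degree_boxProd (χ : Irr W₁) (μ : Irr W₂) :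
    (boxProd (χ, μ)).degree = χ.degree * μ.degree := by
  have h : ((boxProd (χ, μ)).degree : ℂ) = χ.degree * μ.degree := by
    rw [degree_eq, degree_eq, degree_eq, boxProd_apply]
    rfl
  exact_mod_cast h

theorem apply_one_ne_zero [Finite W] (χ : Irr W) : χ 1 ≠ 0 := by
  classical
  have := Fintype.ofFinite W
  intro h0
  rw [← degree_eq, Nat.cast_eq_zero] at h0
  obtain ⟨ρ, -, hρ⟩ := χ.exists_rep
  have h1 : ∀ g, χ g = 0 := fun g => by
    rw [← hρ, Representation.character]
    have : Subsingleton (Fin χ.degree → ℂ) := by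
      rw [h0]
      infer_instance
    rw [Subsingleton.elim (ρ g) 0, map_zero]
  have h2 := orthonormal χ χ
  simp [h1] at h2

/-- Two irreducible characters that are proportional are equal. -/
theorem eq_of_proportional [Finite W] {χ ψ : Irr W} {a b : ℂ} (ha : a ≠ 0)
    (h : ∀ w, χ w * a = ψ w * b) : χ = ψ := by
  classical
  have := Fintype.ofFinite W
  by_contra hne
  have h1 := orthonormal χ χ
  have h2 := orthonormal ψ χ
  rw [if_neg (Ne.symm hne)] at h2
  have h3 : ((Nat.card W : ℂ)⁻¹ * ∑ g : W, χ g * χ g⁻¹) * a =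
      ((Nat.card W : ℂ)⁻¹ * ∑ g : W, ψ g * χ g⁻¹) * b := by
    rw [mul_assoc, mul_assoc, Finset.sum_mul, Finset.sum_mul]
    congr 1
    refine Finset.sum_congr rfl fun g _ => ?_
    linear_combination χ g⁻¹ * h g
  rw [h1, h2, if_pos rfl, one_mul, zero_mul] at h3
  exact ha h3

theorem boxProd_injective : Function.Injective (boxProd : Irr W₁ × Irr W₂ → Irr (W₁ × W₂)) := by
  rintro ⟨χ, μ⟩ ⟨χ', μ'⟩ h
  have h1 : ∀ w₁ w₂, χ w₁ * μ w₂ = χ' w₁ * μ' w₂ := fun w₁ w₂ => by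
    have := boxProd_apply (χ', μ') (w₁, w₂)
    rw [← h, boxProd_apply] at this
    exact this
  -- Fixing one argument at `1` makes the characters of the other factor proportional, with a
  -- nonzero degree as coefficient.
  refine Prod.ext (eq_of_proportional μ.apply_one_ne_zero fun w => h1 w 1)
    (eq_of_proportional χ.apply_one_ne_zero (b := χ' 1) fun w => ?_)
  rw [mul_comm, h1, mul_comm]

theorem boxProd_surjective : Function.Surjective (boxProd : Irr W₁ × Irr W₂ → Irr (W₁ × W₂)) := by
  intro θ
  obtain ⟨ρ, hρ, h⟩ := θ.exists_rep
  obtain ⟨d, τ, d', σ, hτ, hσ, ⟨φ⟩⟩ := Representation.exists_outer_equiv hρ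
  refine ⟨(⟨τ.character, d, τ, hτ, rfl⟩, ⟨σ.character, d', σ, hσ, rfl⟩), Subtype.ext ?_⟩
  funext w
  refine (boxProd_apply _ w).trans ?_
  rw [← h, ← Representation.char_iso φ, Representation.outer_character]

/-- The bijection `(χ, μ) ↦ χ ⊠ μ`. -/
noncomputable def boxEquiv : Irr W₁ × Irr W₂ ≃ Irr (W₁ × W₂) :=
  Equiv.ofBijective boxProd ⟨boxProd_injective, boxProd_surjective⟩

end Irr

theorem isProd_prod {B₁ B₂ : Type*} (M₁ : CoxeterMatrix B₁) (M₂ : CoxeterMatrix B₂) :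
    IsProd M₁ M₂ (M₁.prod M₂) Sum.inl Sum.inr where
  inj₁ := Sum.inl_injective
  inj₂ := Sum.inr_injective
  ne _ _ := Sum.inl_ne_inr
  cover b := by
    rcases b with s | t
    · exact .inl ⟨s, rfl⟩
    · exact .inr ⟨t, rfl⟩
  matrix₁ _ _ := rfl
  matrix₂ _ _ := rfl
  matrix _ _ := rfl

end WGraph

/-! ### The product theorem -/

theorem mainTheorem1 {B₁ B₂ W₁ W₂ : Type*} [Fintype B₁] [DecidableEq B₁] [Fintype B₂]
    [DecidableEq B₂] [Group W₁] [Finite W₁] [Group W₂] [Finite W₂]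
    {M₁ : CoxeterMatrix B₁} {M₂ : CoxeterMatrix B₂}
    (cs₁ : CoxeterSystem M₁ W₁) (cs₂ : CoxeterSystem M₂ W₂)
    (k : Subring ℂ) (hk : WGraph.IsGoodRing k (M₁.prod M₂)) :
    (WGraph.StrongDecompositionConjecture k cs₁ → WGraph.StrongDecompositionConjecture k cs₂ →
      WGraph.StrongDecompositionConjecture k (cs₁.prod cs₂)) ∧
    ∃ box : WGraph.Irr W₁ × WGraph.Irr W₂ ≃ WGraph.Irr (W₁ × W₂),
      (∀ χ₁ χ₂ w₁ w₂, box (χ₁, χ₂) (w₁, w₂) = χ₁ w₁ * χ₂ w₂) ∧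
      ∀ (F₁ : WGraph.Irr W₁ → WGraph.KOmega k M₁) (le₁ : WGraph.Irr W₁ → WGraph.Irr W₁ → Prop)
        (F₂ : WGraph.Irr W₂ → WGraph.KOmega k M₂) (le₂ : WGraph.Irr W₂ → WGraph.Irr W₂ → Prop),
        WGraph.IsStrongDecomposition k cs₁ F₁ le₁ → WGraph.IsStrongDecomposition k cs₂ F₂ le₂ →
        ∃ (F : WGraph.Irr (W₁ × W₂) → WGraph.KOmega k (M₁.prod M₂))
          (le : WGraph.Irr (W₁ × W₂) → WGraph.Irr (W₁ × W₂) → Prop),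
          (∀ χ₁ χ₂, F (box (χ₁, χ₂)) =
            WGraph.iota₁ k M₁ M₂ (F₁ χ₁) * WGraph.iota₂ k M₁ M₂ (F₂ χ₂)) ∧
          (∀ χ₁ χ₂ ψ₁ ψ₂, le (box (χ₁, χ₂)) (box (ψ₁, ψ₂)) ↔ le₁ χ₁ ψ₁ ∧ le₂ χ₂ ψ₂) ∧
          WGraph.IsStrongDecomposition k (cs₁.prod cs₂) F le := by
  have main : ∀ (F₁ : WGraph.Irr W₁ → WGraph.KOmega k M₁)
      (le₁ : WGraph.Irr W₁ → WGraph.Irr W₁ → Prop) (F₂ : WGraph.Irr W₂ → WGraph.KOmega k M₂)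
      (le₂ : WGraph.Irr W₂ → WGraph.Irr W₂ → Prop),
      WGraph.IsStrongDecomposition k cs₁ F₁ le₁ → WGraph.IsStrongDecomposition k cs₂ F₂ le₂ → _ :=
    fun F₁ le₁ F₂ le₂ D₁ D₂ => (WGraph.isProd_prod M₁ M₂).isStrongDecomposition (cs₁.prod cs₂)
      WGraph.Irr.boxEquiv WGraph.Irr.degree_boxProd D₁ D₂
  refine ⟨fun ⟨F₁, le₁, D₁⟩ ⟨F₂, le₂, D₂⟩ => ⟨_, _, main F₁ le₁ F₂ le₂ D₁ D₂⟩,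
    WGraph.Irr.boxEquiv, fun χ₁ χ₂ w₁ w₂ => WGraph.Irr.boxProd_apply (χ₁, χ₂) (w₁, w₂),
    fun F₁ le₁ F₂ le₂ D₁ D₂ => ⟨_, _, fun χ₁ χ₂ => ?_, fun χ₁ χ₂ ψ₁ ψ₂ => ?_,
      main F₁ le₁ F₂ le₂ D₁ D₂⟩⟩
  · simp only [Equiv.symm_apply_apply]
    -- `iota₁` and `iota₂` are `kParabolic` along `Sum.inl` and `Sum.inr` by definition.
    rfl
  · simp only [Equiv.symm_apply_apply]
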